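/- Let $k$ be a field and let $A$ be a Hopf algebra over $k$ with comultiplication $\Delta$, counit $\varepsilon$ and antipode $S$ (Sweedler notation throughout). A (right-right) Yetter–Drinfeld module over $A$ is a right $A$-module and right $A$-comodule $V$ with $$(v\leftarrow a)_{(0)}\otimes (v\leftarrow a)_{(1)} = v_{(0)}\leftarrow a_{(2)}\otimes S(a_{(1)})\,v_{(1)}\,a_{(3)}\qquad (v\in V,\ a\in A);$$ these form an abelian category $\mathcal{YD}_A^A$, the morphisms being the $A$-linear and $A$-colinear maps. Let $k$ also denote the trivial Yetter–Drinfeld module ($v\leftarrow a=\varepsilon(a)v$, $v\mapsto v\otimes 1$), and let $$H^n_{\rm GS}(A,V)=\operatorname{Ext}^n_{\mathcal{YD}_A^A}(k,V)$$ be the Gerstenhaber–Schack cohomology of $A$ with coefficients in $V$. For a right $A$-comodule $X$, let $X\boxtimes A$ be the Yetter–Drinfeld module with underlying space $X\otimes A$, action $(x\otimes a)\leftarrow b=x\otimes ab$ and coaction $x\otimes a\mapsto x_{(0)}\otimes a_{(2)}\otimes S(a_{(1)})x_{(1)}a_{(3)}$. Put $A^{\boxtimes 0}=k$ and $A^{\boxtimes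 (n+1)}=A^{\boxtimes n}\boxtimes A$, so that the underlying space of $A^{\boxtimes n}$ is $A^{\otimes n}$. Let $\operatorname{Hom}^A$ denote the spaces of $A$-colinear maps. Call $V$ relative injective if the functor $\operatorname{Hom}_{\mathcal{YD}_A^A}(-,V)$ transforms the exact sequences of Yetter–Drinfeld modules that split as sequences of $A$-modules into exact sequences of vector spaces. Call $A$ cosemisimple if every right $A$-comodule is semisimple, i.e. every subcomodule has a complementary subcomodule. Let $V$ be a Yetter–Drinfeld module over $A$, and assume that $A$ is cosemisimple or that $V$ is relative injective. Then $H^*_{\rm GS}(A,V)$ is the cohomology of the complex $$0\to \operatorname{Hom}^A(k,V)\xrightarrow{\partial}\operatorname{Hom}^A(A^{\boxtimes 1},V)\xrightarrow{\partial}\cdots\xrightarrow{\partial}\operatorname{Hom}^A(A^{\boxtimes n},V)\xrightarrow{\partial}\operatorname{Hom}^A(A^{\boxtimes (n+1)},V)\xrightarrow{\partial}\cdots$$ (that is, $H^n_{\rm GS}(A,V)$ is isomorphic, as a $k$-vector space, to its $n$-th cohomology for every $n\ge 0$), where $\partial:\operatorname{Hom}^A(A^{\boxtimes n},V)\to\operatorname{Hom}^A(A^{\boxtimes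 (n+1)},V)$ is given by $$\partial(f)(a_1\otimes\cdots\otimes a_{n+1})=\varepsilon(a_1)f(a_2\otimes\cdots\otimes a_{n+1})+\sum_{i=1}^n(-1)^if(a_1\otimes\cdots\otimes a_ia_{i+1}\otimes\cdots\otimes a_{n+1})+(-1)^{n+1}f(a_1\otimes\cdots\otimes a_n)\leftarrow a_{n+1}.$$ -/

import Mathlib

open CategoryTheory TensorProduct

universe u

namespace GerstenhaberSchack


/-- A right comodule over the coalgebra underlying `A`. -/
structure RightComodule (k A : Type u) [Field k] [Ring A] [HopfAlgebra k A] where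
  carrier : Type u
  [addCommGroup : AddCommGroup carrier]
  [module : Module k carrier]
  /-- The coaction `v ↦ v₍₀₎ ⊗ v₍₁₎`. -/
  coact : carrier →ₗ[k] carrier ⊗[k] A
  coassoc : (TensorProduct.assoc k carrier A A).toLinearMap ∘ₗ coact.rTensor A ∘ₗ coact =
    (Coalgebra.comul (R := k) (A := A)).lTensor carrier ∘ₗ coact
  counit_coact : (TensorProduct.rid k carrier).toLinearMap ∘ₗ
    (Coalgebra.counit (R := k) (A := A)).lTensor carrier ∘ₗ coact = LinearMap.id

attribute [instance] RightComodule.addCommGroup RightComodule.module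

section Twist

variable {k A : Type u} [Field k] [Ring A] [HopfAlgebra k A]

/-- `a ↦ a₍₁₎ ⊗ (a₍₂₎ ⊗ a₍₃₎)`. -/
noncomputable def comul₂ : A →ₗ[k] A ⊗[k] (A ⊗[k] A) :=
  (Coalgebra.comul (R := k) (A := A)).lTensor A ∘ₗ Coalgebra.comul

/-- `a ⊗ (b ⊗ c) ↦ (v ⊗ d ↦ g b v ⊗ S(a) d c)`, see `twist_tmul`. -/
noncomputable def twist {V W : Type u} [AddCommGroup V] [Module k V] [AddCommGroup W] [Module k W]
    (g : A →ₗ[k] V →ₗ[k] W) : A ⊗[k] (A ⊗[k] A) →ₗ[k] (V ⊗[k] A →ₗ[k] W ⊗[k] A) :=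
  TensorProduct.homTensorHomMap (RingHom.id k) V A W A ∘ₗ
    TensorProduct.map g
      (LinearMap.mul' k (Module.End k A) ∘ₗ
        TensorProduct.map (LinearMap.mul k A ∘ₗ HopfAlgebra.antipode k) (LinearMap.mul k A).flip) ∘ₗ
    (TensorProduct.leftComm k A A A).toLinearMap

@[simp] lemma twist_tmul {V W : Type u} [AddCommGroup V] [Module k V] [AddCommGroup W] [Module k W]
    (g : A →ₗ[k] V →ₗ[k] W) (a b c : A) (v : V) (d : A) :
    twist g (a ⊗ₜ[k] (b ⊗ₜ[k] c)) (v ⊗ₜ[k] d) =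
      g b v ⊗ₜ[k] (HopfAlgebra.antipode k a * d * c) := by
  simp [twist, mul_assoc]

lemma twist_naturality {V W V' W' : Type u} [AddCommGroup V] [Module k V] [AddCommGroup W]
    [Module k W] [AddCommGroup V'] [Module k V'] [AddCommGroup W'] [Module k W']
    (g : A →ₗ[k] V →ₗ[k] W) (g' : A →ₗ[k] V' →ₗ[k] W') (p : V →ₗ[k] V') (q : W →ₗ[k] W')
    (h : ∀ a v, q (g a v) = g' a (p v)) (u : A ⊗[k] (A ⊗[k] A)) (w : V ⊗[k] A) :
    q.rTensor A (twist g u w) = twist g' u (p.rTensor A w) := by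
  induction u using TensorProduct.induction_on with
  | zero => simp
  | add x y hx hy => simp only [map_add, LinearMap.add_apply, hx, hy]
  | tmul a t =>
    induction t using TensorProduct.induction_on with
    | zero => simp
    | add x y hx hy => simp only [tmul_add, map_add, LinearMap.add_apply, hx, hy]
    | tmul b c =>
      induction w using TensorProduct.induction_on with
      | zero => simp
      | add x y hx hy => simp only [map_add, hx, hy]
      | tmul v d => simp [h]

lemma comul₂_mul (a b : A) : comul₂ (k := k) (a * b) = comul₂ (k := k) a * comul₂ (k := k) b := by
  let Φ : A →ₐ[k] A ⊗[k] (A ⊗[k] A) := (Algebra.TensorProduct.map (AlgHom.id k A)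
      (Bialgebra.comulAlgHom k A)).comp (Bialgebra.comulAlgHom k A)
  exact map_mul Φ a b

lemma comul₂_one : comul₂ (k := k) (1 : A) = 1 ⊗ₜ (1 ⊗ₜ 1) := by
  simp [comul₂, Algebra.TensorProduct.one_def]

lemma twist_mul {V W U : Type u} [AddCommGroup V] [Module k V] [AddCommGroup W] [Module k W]
    [AddCommGroup U] [Module k U]
    (g : A →ₗ[k] V →ₗ[k] W) (h : A →ₗ[k] W →ₗ[k] U) (l : A →ₗ[k] V →ₗ[k] U)
    (hl : ∀ a b v, l (a * b) v = h b (g a v)) (s t : A ⊗[k] (A ⊗[k] A)) (w : V ⊗[k] A) :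
    twist l (s * t) w = twist h t (twist g s w) := by
  induction s using TensorProduct.induction_on with
  | zero => simp
  | add x y hx hy => simp only [add_mul, map_add, LinearMap.add_apply, hx, hy]
  | tmul a s =>
  induction s using TensorProduct.induction_on with
  | zero => simp
  | add x y hx hy => simp only [add_mul, tmul_add, map_add, LinearMap.add_apply, hx, hy]
  | tmul b c =>
  induction t using TensorProduct.induction_on with
  | zero => simp
  | add x y hx hy => simp only [mul_add, map_add, LinearMap.add_apply, hx, hy]
  | tmul a' t =>
  induction t using TensorProduct.induction_on with
  | zero => simp
  | add x y hx hy => simp only [mul_add, tmul_add, map_add, LinearMap.add_apply, hx, hy]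
  | tmul b' c' =>
  induction w using TensorProduct.induction_on with
  | zero => simp
  | add x y hx hy => simp only [map_add, hx, hy]
  | tmul v d => simp [hl, HopfAlgebra.antipode_mul_antidistrib, mul_assoc]

/-- The antipode reverses the comultiplication. -/
lemma comul_antipode (a : A) :
    Coalgebra.comul (R := k) (HopfAlgebra.antipode k a) =
      TensorProduct.map (HopfAlgebra.antipode k) (HopfAlgebra.antipode k)
        (TensorProduct.comm k A A (Coalgebra.comul a)) := by
  let F : WithConv (A →ₗ[k] A ⊗[k] A) :=
    WithConv.toConv (Coalgebra.comul ∘ₗ HopfAlgebra.antipode k)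
  let G : WithConv (A →ₗ[k] A ⊗[k] A) :=
    WithConv.toConv (TensorProduct.map (HopfAlgebra.antipode k) (HopfAlgebra.antipode k) ∘ₗ
        (TensorProduct.comm k A A).toLinearMap ∘ₗ Coalgebra.comul)
  have h1 : WithConv.toConv Coalgebra.comul * F = 1 := LinearMap.comul_right_inv
  have h2 : G * WithConv.toConv Coalgebra.comul = 1 := by
    apply WithConv.ofConv_injective
    let P : A ⊗[k] A →ₗ[k] A := LinearMap.mul' k A ∘ₗ (HopfAlgebra.antipode k).rTensor A
    have hP : P ∘ₗ Coalgebra.comul = Algebra.linearMap k A ∘ₗ Coalgebra.counit :=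
      HopfAlgebra.mul_antipode_rTensor_comul
    let M : A ⊗[k] (A ⊗[k] A) →ₗ[k] A ⊗[k] A :=
      P.lTensor A ∘ₗ (TensorProduct.leftComm k A A A).toLinearMap
    have key : LinearMap.mul' k (A ⊗[k] A) ∘ₗ TensorProduct.map
        (TensorProduct.map (HopfAlgebra.antipode k) (HopfAlgebra.antipode k) ∘ₗ
          (TensorProduct.comm k A A).toLinearMap) LinearMap.id =
        M ∘ₗ (P.rTensor A ∘ₗ (TensorProduct.assoc k A A A).symm.toLinearMap).lTensor A ∘ₗ
          (TensorProduct.assoc k A A (A ⊗[k] A)).toLinearMap := by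
      ext a b c d
      simp [M, P]
    change LinearMap.mul' k (A ⊗[k] A) ∘ₗ TensorProduct.map
        (TensorProduct.map (HopfAlgebra.antipode k) (HopfAlgebra.antipode k) ∘ₗ
          (TensorProduct.comm k A A).toLinearMap ∘ₗ Coalgebra.comul) Coalgebra.comul ∘ₗ
          Coalgebra.comul = Algebra.linearMap k (A ⊗[k] A) ∘ₗ Coalgebra.counit
    calc _ = (LinearMap.mul' k (A ⊗[k] A) ∘ₗ TensorProduct.map
        (TensorProduct.map (HopfAlgebra.antipode k) (HopfAlgebra.antipode k) ∘ₗ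
          (TensorProduct.comm k A A).toLinearMap) LinearMap.id) ∘ₗ
          TensorProduct.map Coalgebra.comul Coalgebra.comul ∘ₗ Coalgebra.comul := by
            simp only [LinearMap.comp_assoc, CoassocSimps.TensorProduct.map_comp_assoc,
              LinearMap.id_comp]
      _ = M ∘ₗ (P.rTensor A ∘ₗ (TensorProduct.assoc k A A A).symm.toLinearMap ∘ₗ
            Coalgebra.comul.lTensor A ∘ₗ Coalgebra.comul).lTensor A ∘ₗ Coalgebra.comul := by
            rw [key]; simp only [coassoc_simps]
      _ = M ∘ₗ ((P ∘ₗ Coalgebra.comul).rTensor A ∘ₗ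
            Coalgebra.comul).lTensor A ∘ₗ Coalgebra.comul := by
            simp only [coassoc_simps]
      _ = M ∘ₗ (TensorProduct.mk k A A 1).lTensor A ∘ₗ Coalgebra.comul := by
            have : (P ∘ₗ Coalgebra.comul).rTensor A ∘ₗ Coalgebra.comul =
                TensorProduct.mk k A A 1 := by
              rw [hP, LinearMap.rTensor_comp, LinearMap.comp_assoc,
                Coalgebra.rTensor_counit_comp_comul]
              ext a; simp
            rw [this]
      _ = (TensorProduct.mk k A A 1) ∘ₗ P ∘ₗ Coalgebra.comul := by
            rw [← LinearMap.comp_assoc, ← LinearMap.comp_assoc]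
            congr 1
            ext a b; simp [M]
      _ = _ := by
            rw [hP]; ext a; simp [Algebra.algebraMap_eq_smul_one, Algebra.TensorProduct.one_def]
  have := left_inv_eq_right_inv h2 h1
  exact (LinearMap.congr_fun (congrArg WithConv.ofConv this) a).symm


lemma comul₂_comul₂ : ((comul₂ (k := k) (A := A)).rTensor A).lTensor A ∘ₗ comul₂ =
    ((TensorProduct.assoc k A (A ⊗[k] A) A).symm.toLinearMap ∘ₗ
      ((TensorProduct.assoc k A A A).symm.toLinearMap).lTensor A).lTensor A ∘ₗ
      (TensorProduct.assoc k A A (A ⊗[k] (A ⊗[k] A))).toLinearMap ∘ₗ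
      TensorProduct.map (Coalgebra.comul (R := k) (A := A))
        ((Coalgebra.comul (R := k) (A := A)).lTensor A) ∘ₗ comul₂ := by
  simp only [comul₂, coassoc_simps]

variable (M : RightComodule k A)

/-- The coaction `v ⊗ a ↦ (v₍₀₎ ⊗ a₍₂₎) ⊗ S(a₍₁₎) v₍₁₎ a₍₃₎` on `M ⊗ A`. -/
noncomputable def freeCoact : M.carrier ⊗[k] A →ₗ[k] (M.carrier ⊗[k] A) ⊗[k] A :=
  TensorProduct.lift
    ((twist (TensorProduct.mk k M.carrier A).flip ∘ₗ comul₂).flip ∘ₗ M.coact)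

@[simp] lemma freeCoact_tmul (v : M.carrier) (a : A) :
    freeCoact M (v ⊗ₜ a) = twist (TensorProduct.mk k M.carrier A).flip (comul₂ a) (M.coact v) := rfl

/-- The map `a ⊗ ((b ⊗ (c ⊗ d)) ⊗ e) ↦ ((v ⊗ x) ⊗ y ↦ (v ⊗ c) ⊗ (S(b) x d ⊗ S(a) y e))`. -/
noncomputable def twist₂ {V W : Type u} [AddCommGroup V] [Module k V] [AddCommGroup W] [Module k W]
    (g : A →ₗ[k] V →ₗ[k] W) : A ⊗[k] ((A ⊗[k] (A ⊗[k] A)) ⊗[k] A) →ₗ[k]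
      ((V ⊗[k] A) ⊗[k] A →ₗ[k] (W ⊗[k] A) ⊗[k] A) :=
  TensorProduct.homTensorHomMap (RingHom.id k) (V ⊗[k] A) A (W ⊗[k] A) A ∘ₗ
    TensorProduct.map (twist g)
      (LinearMap.mul' k (Module.End k A) ∘ₗ
        TensorProduct.map (LinearMap.mul k A ∘ₗ HopfAlgebra.antipode k) (LinearMap.mul k A).flip) ∘ₗ
    (TensorProduct.leftComm k A (A ⊗[k] (A ⊗[k] A)) A).toLinearMap

lemma twist₂_tmul {V W : Type u} [AddCommGroup V] [Module k V] [AddCommGroup W] [Module k W]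
    (g : A →ₗ[k] V →ₗ[k] W) (a b : A) (t : A ⊗[k] (A ⊗[k] A)) (v : V ⊗[k] A) (d : A) :
    twist₂ g (a ⊗ₜ[k] (t ⊗ₜ[k] b)) (v ⊗ₜ[k] d) =
      twist g t v ⊗ₜ[k] (HopfAlgebra.antipode k a * d * b) := by
  simp [twist₂, mul_assoc]

lemma freeCoact_coassoc_left (u : A ⊗[k] (A ⊗[k] A)) (w : M.carrier ⊗[k] A) :
    (freeCoact M).rTensor A (twist (TensorProduct.mk k M.carrier A).flip u w) =
      twist₂ (TensorProduct.mk k M.carrier A).flip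
        ((comul₂ (k := k) (A := A)).rTensor A |>.lTensor A <| u) (M.coact.rTensor A w) := by
  induction u using TensorProduct.induction_on with
  | zero => simp
  | add x y hx hy => simp only [map_add, LinearMap.add_apply, hx, hy]
  | tmul a t =>
  induction t using TensorProduct.induction_on with
  | zero => simp
  | add x y hx hy => simp only [tmul_add, map_add, LinearMap.add_apply, hx, hy]
  | tmul b c =>
  induction w using TensorProduct.induction_on with
  | zero => simp
  | add x y hx hy => simp only [map_add, hx, hy]
  | tmul v d => simp [twist₂_tmul]

lemma twist_coassoc_right {V W : Type u} [AddCommGroup V] [Module k V] [AddCommGroup W] [Module k W]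
    (g : A →ₗ[k] V →ₗ[k] W) (u : A ⊗[k] (A ⊗[k] A)) (w : V ⊗[k] A) :
    (Coalgebra.comul (R := k) (A := A)).lTensor W (twist g u w) =
      TensorProduct.assoc k W A A (twist₂ g
        ((((TensorProduct.assoc k A (A ⊗[k] A) A).symm.toLinearMap ∘ₗ
      ((TensorProduct.assoc k A A A).symm.toLinearMap).lTensor A).lTensor A ∘ₗ
      (TensorProduct.assoc k A A (A ⊗[k] (A ⊗[k] A))).toLinearMap ∘ₗ
      TensorProduct.map (Coalgebra.comul (R := k) (A := A))
        ((Coalgebra.comul (R := k) (A := A)).lTensor A)) u)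
        ((TensorProduct.assoc k V A A).symm
          ((Coalgebra.comul (R := k) (A := A)).lTensor V w))) := by
  induction u using TensorProduct.induction_on with
  | zero => simp
  | add x y hx hy => simp only [map_add, LinearMap.add_apply, hx, hy]
  | tmul a t =>
  induction t using TensorProduct.induction_on with
  | zero => simp
  | add x y hx hy => simp only [tmul_add, map_add, LinearMap.add_apply, hx, hy]
  | tmul b c =>
  induction w using TensorProduct.induction_on with
  | zero => simp
  | add x y hx hy => simp only [map_add, hx, hy]
  | tmul v d =>
    simp only [twist_tmul, LinearMap.lTensor_tmul, Bialgebra.comul_mul, comul_antipode,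
      LinearMap.comp_apply, TensorProduct.map_tmul, LinearEquiv.coe_coe]
    generalize Coalgebra.comul (R := k) a = x
    generalize Coalgebra.comul (R := k) c = z
    generalize Coalgebra.comul (R := k) d = y
    induction x using TensorProduct.induction_on with
    | zero => simp
    | add x y hx hy => simp only [map_add, LinearMap.add_apply, add_mul, add_tmul, tmul_add, hx, hy]
    | tmul a₁ a₂ =>
    induction y using TensorProduct.induction_on with
    | zero => simp
    | add x y hx hy =>
      simp only [map_add, mul_add, add_mul, tmul_add, hx, hy]
    | tmul d₁ d₂ =>
    induction z using TensorProduct.induction_on with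
    | zero => simp
    | add x y hx hy =>
      simp only [map_add, LinearMap.add_apply, mul_add, tmul_add, hx, hy]
    | tmul c₁ c₂ =>
      simp [twist₂_tmul]

lemma twist_counit {V W : Type u} [AddCommGroup V] [Module k V] [AddCommGroup W] [Module k W]
    (g : A →ₗ[k] V →ₗ[k] W) (u : A ⊗[k] (A ⊗[k] A)) (w : V ⊗[k] A) :
    TensorProduct.rid k W ((Coalgebra.counit (R := k) (A := A)).lTensor W (twist g u w)) =
      g (TensorProduct.lid k A (TensorProduct.map Coalgebra.counit
          ((TensorProduct.rid k A).toLinearMap ∘ₗ Coalgebra.counit.lTensor A) u))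
        (TensorProduct.rid k V ((Coalgebra.counit (R := k) (A := A)).lTensor V w)) := by
  induction u using TensorProduct.induction_on with
  | zero => simp
  | add x y hx hy => simp only [map_add, LinearMap.add_apply, hx, hy]
  | tmul a t =>
  induction t using TensorProduct.induction_on with
  | zero => simp
  | add x y hx hy => simp only [tmul_add, map_add, LinearMap.add_apply, hx, hy]
  | tmul b c =>
  induction w using TensorProduct.induction_on with
  | zero => simp
  | add x y hx hy => simp only [map_add, hx, hy]
  | tmul v d => simp [smul_smul]; congr 1; ring

lemma comul₂_counit (a : A) : TensorProduct.lid k A (TensorProduct.map Coalgebra.counit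
    ((TensorProduct.rid k A).toLinearMap ∘ₗ Coalgebra.counit.lTensor A) (comul₂ (k := k) a)) = a := by
  have h : ((TensorProduct.rid k A).toLinearMap ∘ₗ Coalgebra.counit.lTensor A) ∘ₗ
      Coalgebra.comul (R := k) (A := A) = LinearMap.id := by
    rw [LinearMap.comp_assoc, Coalgebra.lTensor_counit_comp_comul]; ext; simp
  rw [comul₂, LinearMap.comp_apply, ← LinearMap.comp_apply (TensorProduct.map _ _),
    LinearMap.map_comp_lTensor, h]
  have := Coalgebra.rTensor_counit_comul (R := k) a
  rw [LinearMap.rTensor] at this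
  simp [this]

lemma freeCoact_coassoc : (TensorProduct.assoc k (M.carrier ⊗[k] A) A A).toLinearMap ∘ₗ
    (freeCoact M).rTensor A ∘ₗ freeCoact M =
    (Coalgebra.comul (R := k) (A := A)).lTensor (M.carrier ⊗[k] A) ∘ₗ freeCoact M := by
  ext v a
  have h1 := LinearMap.congr_fun M.coassoc v
  have h2 := LinearMap.congr_fun (comul₂_comul₂ (k := k) (A := A)) a
  simp only [AlgebraTensorModule.curry_apply, LinearMap.restrictScalars_self, curry_apply,
    LinearMap.comp_apply, freeCoact_tmul, LinearEquiv.coe_coe] at h1 h2 ⊢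
  rw [freeCoact_coassoc_left, twist_coassoc_right, h2, ← h1, LinearEquiv.symm_apply_apply]
  rfl

lemma freeCoact_counit : (TensorProduct.rid k (M.carrier ⊗[k] A)).toLinearMap ∘ₗ
    (Coalgebra.counit (R := k) (A := A)).lTensor (M.carrier ⊗[k] A) ∘ₗ freeCoact M =
      LinearMap.id := by
  ext v a
  have h1 := LinearMap.congr_fun M.counit_coact v
  simp only [LinearMap.comp_apply, LinearEquiv.coe_coe, LinearMap.id_apply] at h1
  simp only [AlgebraTensorModule.curry_apply, LinearMap.restrictScalars_self, curry_apply,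
    LinearMap.comp_apply, freeCoact_tmul, LinearEquiv.coe_coe]
  rw [twist_counit, comul₂_counit, h1]
  rfl

end Twist


section Comodules

variable {k A : Type u} [Field k] [Ring A] [HopfAlgebra k A]

/-- `Hom^A(M, N)`: the space of morphisms of right comodules. -/
def RightComodule.colinearMaps (M N : RightComodule k A) :
    Submodule k (M.carrier →ₗ[k] N.carrier) where
  carrier := {f | f.rTensor A ∘ₗ M.coact = N.coact ∘ₗ f}
  add_mem' {f g} hf hg := by
    simp only [Set.mem_ofPred_eq] at *
    rw [LinearMap.rTensor_add, LinearMap.add_comp, LinearMap.comp_add, hf, hg]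
  zero_mem' := by simp
  smul_mem' c f hf := by
    simp only [Set.mem_ofPred_eq] at *
    rw [LinearMap.rTensor_smul, LinearMap.smul_comp, LinearMap.comp_smul, hf]

lemma RightComodule.mem_colinearMaps {M N : RightComodule k A} {f : M.carrier →ₗ[k] N.carrier} :
    f ∈ M.colinearMaps N ↔ ∀ v, f.rTensor A (M.coact v) = N.coact (f v) :=
  LinearMap.ext_iff

/-- A subspace `W` with `coact W ⊆ W ⊗ A`. -/
def RightComodule.IsSubcomodule (M : RightComodule k A) (W : Submodule k M.carrier) : Prop :=
  ∀ w ∈ W, M.coact w ∈ LinearMap.range (W.subtype.rTensor A)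

variable (k A) in
/-- `A` is cosemisimple: every right `A`-comodule is semisimple (completely reducible), that is,
every subcomodule has a complementary subcomodule. -/
def IsCosemisimple : Prop :=
  ∀ (M : RightComodule k A) (W : Submodule k M.carrier), M.IsSubcomodule W →
    ∃ W' : Submodule k M.carrier, M.IsSubcomodule W' ∧ IsCompl W W'

end Comodules

/-- A right-right Yetter-Drinfeld module; `act a v` is `v ← a`. The last axiom says
`(v ← a)₍₀₎ ⊗ (v ← a)₍₁₎ = v₍₀₎ ← a₍₂₎ ⊗ S(a₍₁₎) v₍₁₎ a₍₃₎`. -/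
structure YDModule (k A : Type u) [Field k] [Ring A] [HopfAlgebra k A] extends
    RightComodule k A where
  act : A →ₗ[k] carrier →ₗ[k] carrier
  act_one : act 1 = LinearMap.id
  act_mul (a b : A) : act (a * b) = act b ∘ₗ act a
  coact_act (a : A) (v : carrier) : coact (act a v) = twist act (comul₂ a) (coact v)

namespace YDModule

variable {k A : Type u} [Field k] [Ring A] [HopfAlgebra k A]

/-- `Hom_A(M, N)`: the space of morphisms of right modules. -/
def linearMaps (M N : YDModule k A) : Submodule k (M.carrier →ₗ[k] N.carrier) where
  carrier := {f | ∀ a v, f (M.act a v) = N.act a (f v)}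
  add_mem' {f g} hf hg a v := by simp [hf a v, hg a v]
  zero_mem' a v := by simp
  smul_mem' c f hf a v := by simp [hf a v]

lemma mem_linearMaps {M N : YDModule k A} {f : M.carrier →ₗ[k] N.carrier} :
    f ∈ M.linearMaps N ↔ ∀ a v, f (M.act a v) = N.act a (f v) := Iff.rfl

/-- The morphisms of Yetter-Drinfeld modules: the linear and colinear maps. -/
abbrev homs (M N : YDModule k A) : Submodule k (M.carrier →ₗ[k] N.carrier) :=
  M.linearMaps N ⊓ M.colinearMaps N.toRightComodule

/-- The category of Yetter-Drinfeld modules. -/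
instance : Category (YDModule k A) where
  Hom M N := M.homs N
  id M := ⟨LinearMap.id, fun _ _ => rfl, RightComodule.mem_colinearMaps.2 fun v => by simp⟩
  comp f g := ⟨g.1 ∘ₗ f.1, fun a v => by simp [f.2.1 a v, g.2.1 a],
    RightComodule.mem_colinearMaps.2 fun v => by
      rw [LinearMap.rTensor_comp, LinearMap.comp_apply,
        RightComodule.mem_colinearMaps.1 f.2.2, RightComodule.mem_colinearMaps.1 g.2.2]; rfl⟩

/-- The linear map underlying a morphism. -/
def lin {M N : YDModule k A} (f : M ⟶ N) : M.carrier →ₗ[k] N.carrier := Subtype.val f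

@[ext] lemma hom_ext {M N : YDModule k A} {f g : M ⟶ N} (h : lin f = lin g) : f = g :=
  Subtype.ext h

@[simp] lemma lin_id (M : YDModule k A) : lin (𝟙 M) = LinearMap.id := rfl

@[simp] lemma lin_comp {M N P : YDModule k A} (f : M ⟶ N) (g : N ⟶ P) :
    lin (f ≫ g) = lin g ∘ₗ lin f := rfl

lemma lin_act {M N : YDModule k A} (f : M ⟶ N) (a : A) (v : M.carrier) :
    lin f (M.act a v) = N.act a (lin f v) := f.2.1 a v

lemma lin_coact {M N : YDModule k A} (f : M ⟶ N) (v : M.carrier) :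
    (lin f).rTensor A (M.coact v) = N.coact (lin f v) := RightComodule.mem_colinearMaps.1 f.2.2 v

/-- Constructor for morphisms. -/
def mkHom {M N : YDModule k A} (f : M.carrier →ₗ[k] N.carrier)
    (h₁ : ∀ a v, f (M.act a v) = N.act a (f v))
    (h₂ : ∀ v, f.rTensor A (M.coact v) = N.coact (f v)) : M ⟶ N :=
  ⟨f, h₁, RightComodule.mem_colinearMaps.2 h₂⟩

@[simp] lemma lin_mkHom {M N : YDModule k A} (f : M.carrier →ₗ[k] N.carrier) (h₁) (h₂) :
    lin (mkHom (M := M) (N := N) f h₁ h₂) = f := rfl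

instance : Preadditive (YDModule k A) where
  homGroup M N := inferInstanceAs (AddCommGroup (M.homs N))
  add_comp _ _ _ f f' g := hom_ext (LinearMap.comp_add (lin f) (lin f') (lin g))
  comp_add _ _ _ f g g' := hom_ext (LinearMap.add_comp (lin f) (lin g') (lin g))

instance : Linear k (YDModule k A) where
  homModule M N := inferInstanceAs (Module k (M.homs N))
  smul_comp _ _ _ r f g := hom_ext (LinearMap.comp_smul (lin g) r (lin f))
  comp_smul _ _ _ f r g := hom_ext (LinearMap.smul_comp r (lin g) (lin f))

@[simp] lemma lin_zero (M N : YDModule k A) : lin (0 : M ⟶ N) = 0 := rfl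
@[simp] lemma lin_add {M N : YDModule k A} (f g : M ⟶ N) : lin (f + g) = lin f + lin g := rfl
@[simp] lemma lin_smul {M N : YDModule k A} (r : k) (f : M ⟶ N) : lin (r • f) = r • lin f := rfl

/-! ### The category is abelian -/

/-- The structure induced on `K` by an injective map to a Yetter-Drinfeld module. -/
def ofInjective (M : YDModule k A) (K : Type u) [AddCommGroup K] [Module k K]
    (act : A →ₗ[k] K →ₗ[k] K) (coact : K →ₗ[k] K ⊗[k] A) (j : K →ₗ[k] M.carrier)
    (hj : Function.Injective j) (h₁ : ∀ a v, j (act a v) = M.act a (j v))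
    (h₂ : ∀ v, j.rTensor A (coact v) = M.coact (j v)) : YDModule k A where
  carrier := K
  coact := coact
  coassoc := by
    have hj2 : Function.Injective ((j.rTensor (A ⊗[k] A))) :=
      Module.Flat.rTensor_preserves_injective_linearMap _ hj
    have h₂' : j.rTensor A ∘ₗ coact = M.coact ∘ₗ j := LinearMap.ext h₂
    ext v
    apply hj2
    have := LinearMap.congr_fun M.coassoc (j v)
    simp only [LinearMap.comp_apply, LinearEquiv.coe_coe] at this ⊢
    have e1 : ∀ x, j.rTensor (A ⊗[k] A) (TensorProduct.assoc k K A A x) =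
        TensorProduct.assoc k M.carrier A A ((j.rTensor A).rTensor A x) := fun x => by
      refine LinearMap.congr_fun (f := (j.rTensor (A ⊗[k] A)) ∘ₗ
        (TensorProduct.assoc k K A A).toLinearMap) (g :=
        (TensorProduct.assoc k M.carrier A A).toLinearMap ∘ₗ ((j.rTensor A).rTensor A)) ?_ x
      ext; simp
    rw [e1, ← LinearMap.comp_apply (LinearMap.rTensor A (LinearMap.rTensor A j)),
      ← LinearMap.rTensor_comp, h₂', LinearMap.rTensor_comp, LinearMap.comp_apply, h₂, this,
      ← h₂, ← LinearMap.comp_apply (LinearMap.lTensor _ _), ← LinearMap.comp_apply (LinearMap.rTensor _ _),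
      LinearMap.lTensor_comp_rTensor, LinearMap.rTensor_comp_lTensor]
  counit_coact := by
    ext v
    apply hj
    have := LinearMap.congr_fun M.counit_coact (j v)
    simp only [LinearMap.comp_apply, LinearEquiv.coe_coe, LinearMap.id_apply] at this ⊢
    have e1 : ∀ x, j (TensorProduct.rid k K x) =
        TensorProduct.rid k M.carrier (j.rTensor k x) := fun x => by
      refine LinearMap.congr_fun (f := j ∘ₗ
        (TensorProduct.rid k K).toLinearMap) (g :=
        (TensorProduct.rid k M.carrier).toLinearMap ∘ₗ (j.rTensor k)) ?_ x
      ext; simp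
    rw [e1, ← LinearMap.comp_apply (LinearMap.rTensor _ _), LinearMap.rTensor_comp_lTensor]
    rw [← h₂, ← LinearMap.comp_apply (LinearMap.lTensor _ _),
      LinearMap.lTensor_comp_rTensor] at this
    exact this
  act := act
  act_one := by ext v; apply hj; simp [h₁, M.act_one]
  act_mul a b := by ext v; apply hj; simp [h₁, M.act_mul]
  coact_act a v := by
    have hj1 : Function.Injective (j.rTensor A) :=
      Module.Flat.rTensor_preserves_injective_linearMap _ hj
    apply hj1
    rw [h₂, h₁, M.coact_act, twist_naturality act M.act j j h₁, h₂]


lemma coassoc_apply (M : YDModule k A) {Q : Type u} [AddCommGroup Q] [Module k Q]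
    (coact : Q →ₗ[k] Q ⊗[k] A) (q : M.carrier →ₗ[k] Q)
    (h₂ : ∀ v, q.rTensor A (M.coact v) = coact (q v)) (v : M.carrier) :
    TensorProduct.assoc k Q A A (coact.rTensor A (coact (q v))) =
      (Coalgebra.comul (R := k) (A := A)).lTensor Q (coact (q v)) := by
  have h₂' : q.rTensor A ∘ₗ M.coact = coact ∘ₗ q := LinearMap.ext h₂
  have := congrArg (q.rTensor (A ⊗[k] A)) (LinearMap.congr_fun M.coassoc v)
  simp only [LinearMap.comp_apply, LinearEquiv.coe_coe] at this
  have e1 : ∀ x, q.rTensor (A ⊗[k] A) (TensorProduct.assoc k M.carrier A A x) =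
      TensorProduct.assoc k Q A A ((q.rTensor A).rTensor A x) := fun x => by
    refine LinearMap.congr_fun (f := (q.rTensor (A ⊗[k] A)) ∘ₗ
      (TensorProduct.assoc k M.carrier A A).toLinearMap) (g :=
      (TensorProduct.assoc k Q A A).toLinearMap ∘ₗ ((q.rTensor A).rTensor A)) ?_ x
    ext; simp
  rw [e1, ← LinearMap.comp_apply (LinearMap.rTensor A (LinearMap.rTensor A q)),
    ← LinearMap.rTensor_comp, h₂', LinearMap.rTensor_comp, LinearMap.comp_apply, h₂,
    ← LinearMap.comp_apply (LinearMap.rTensor (A ⊗[k] A) q),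
    LinearMap.rTensor_comp_lTensor, ← LinearMap.lTensor_comp_rTensor, LinearMap.comp_apply,
    h₂] at this
  exact this

lemma counit_apply (M : YDModule k A) {Q : Type u} [AddCommGroup Q] [Module k Q]
    (coact : Q →ₗ[k] Q ⊗[k] A) (q : M.carrier →ₗ[k] Q)
    (h₂ : ∀ v, q.rTensor A (M.coact v) = coact (q v)) (v : M.carrier) :
    TensorProduct.rid k Q ((Coalgebra.counit (R := k) (A := A)).lTensor Q (coact (q v))) = q v := by
  have := congrArg q (LinearMap.congr_fun M.counit_coact v)
  simp only [LinearMap.comp_apply, LinearEquiv.coe_coe, LinearMap.id_apply] at this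
  have e1 : ∀ x, q (TensorProduct.rid k M.carrier x) =
      TensorProduct.rid k Q (q.rTensor k x) := fun x => by
    refine LinearMap.congr_fun (f := q ∘ₗ
      (TensorProduct.rid k M.carrier).toLinearMap) (g :=
      (TensorProduct.rid k Q).toLinearMap ∘ₗ (q.rTensor k)) ?_ x
    ext; simp
  rw [e1, ← LinearMap.comp_apply (LinearMap.rTensor _ _), LinearMap.rTensor_comp_lTensor,
    ← LinearMap.lTensor_comp_rTensor, LinearMap.comp_apply, h₂] at this
  exact this

lemma coact_act_apply (M : YDModule k A) {Q : Type u} [AddCommGroup Q] [Module k Q]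
    (act : A →ₗ[k] Q →ₗ[k] Q) (coact : Q →ₗ[k] Q ⊗[k] A) (q : M.carrier →ₗ[k] Q)
    (h₁ : ∀ a v, q (M.act a v) = act a (q v)) (h₂ : ∀ v, q.rTensor A (M.coact v) = coact (q v))
    (a : A) (v : M.carrier) :
    coact (act a (q v)) = twist act (comul₂ a) (coact (q v)) := by
  rw [← h₂, ← h₁, ← twist_naturality M.act act q q h₁, ← M.coact_act, h₂]

/-- The structure induced on `Q` by a surjective map from a Yetter-Drinfeld module. -/
def ofSurjective (M : YDModule k A) (Q : Type u) [AddCommGroup Q] [Module k Q]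
    (act : A →ₗ[k] Q →ₗ[k] Q) (coact : Q →ₗ[k] Q ⊗[k] A) (q : M.carrier →ₗ[k] Q)
    (hq : Function.Surjective q) (h₁ : ∀ a v, q (M.act a v) = act a (q v))
    (h₂ : ∀ v, q.rTensor A (M.coact v) = coact (q v)) : YDModule k A where
  carrier := Q
  coact := coact
  coassoc := LinearMap.ext <| hq.forall.2 fun v => coassoc_apply M coact q h₂ v
  counit_coact := LinearMap.ext <| hq.forall.2 fun v => counit_apply M coact q h₂ v
  act := act
  act_one := LinearMap.ext <| hq.forall.2 fun v => by simp [← h₁, M.act_one]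
  act_mul a b := LinearMap.ext <| hq.forall.2 fun v => by simp [← h₁, M.act_mul]
  coact_act a := hq.forall.2 fun v => coact_act_apply M act coact q h₁ h₂ a v

/-- Lifting a morphism through an injective morphism. -/
lemma exists_lift {M N P : YDModule k A} (f : M ⟶ N) (hf : Function.Injective (lin f)) (g : P ⟶ N)
    (h : LinearMap.range (lin g) ≤ LinearMap.range (lin f)) : ∃ l : P ⟶ M, l ≫ f = g := by
  have hf2 : Function.Injective ((lin f).rTensor A) :=
    Module.Flat.rTensor_preserves_injective_linearMap _ hf
  let e := LinearEquiv.ofInjective (lin f) hf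
  let l : P.carrier →ₗ[k] M.carrier :=
    e.symm.toLinearMap ∘ₗ (lin g).codRestrict _ (fun v => h ⟨v, rfl⟩)
  have hl : ∀ v, lin f (l v) = lin g v := fun v => by
    have := e.apply_symm_apply ((lin g).codRestrict _ (fun v => h ⟨v, rfl⟩) v)
    exact congrArg Subtype.val this
  have hl' : lin f ∘ₗ l = lin g := LinearMap.ext hl
  refine ⟨mkHom l (fun a v => hf ?_) (fun v => hf2 ?_), hom_ext hl'⟩
  · rw [hl, lin_act, lin_act, hl]
  · rw [← LinearMap.comp_apply, ← LinearMap.rTensor_comp, hl', lin_coact, lin_coact, hl]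

/-- Factoring a morphism through a surjective morphism. -/
lemma exists_desc {M N P : YDModule k A} (f : M ⟶ N) (hf : Function.Surjective (lin f)) (g : M ⟶ P)
    (h : LinearMap.ker (lin f) ≤ LinearMap.ker (lin g)) : ∃ l : N ⟶ P, f ≫ l = g := by
  let e := (lin f).quotKerEquivOfSurjective hf
  let l : N.carrier →ₗ[k] P.carrier := (LinearMap.ker (lin f)).liftQ (lin g) h ∘ₗ e.symm.toLinearMap
  have hl : ∀ v, l (lin f v) = lin g v := fun v => by
    have : e.symm (lin f v) = (LinearMap.ker (lin f)).mkQ v := by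
      rw [LinearEquiv.symm_apply_eq]; rfl
    simp [l, this]
  have hl' : l ∘ₗ lin f = lin g := LinearMap.ext hl
  refine ⟨mkHom l (fun a v => ?_) (fun v => ?_), hom_ext hl'⟩
  · obtain ⟨v, rfl⟩ := hf v
    rw [← lin_act, hl, hl, lin_act]
  · obtain ⟨v, rfl⟩ := hf v
    rw [← lin_coact, ← LinearMap.comp_apply, ← LinearMap.rTensor_comp, hl', lin_coact, hl]

end YDModule

namespace YDModule

variable {k A : Type u} [Field k] [Ring A] [HopfAlgebra k A]

lemma exists_kernel {M N : YDModule k A} (f : M ⟶ N) :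
    ∃ (K : YDModule k A) (i : K ⟶ M), Function.Injective (lin i) ∧
      LinearMap.range (lin i) = LinearMap.ker (lin f) := by
  let W := LinearMap.ker (lin f)
  have hj1 : Function.Injective (W.subtype.rTensor A) :=
    Module.Flat.rTensor_preserves_injective_linearMap _ W.injective_subtype
  have hex : Function.Exact (W.subtype.rTensor A) ((lin f).rTensor A) :=
    Module.Flat.rTensor_exact A (LinearMap.exact_subtype_ker_map (lin f))
  have hmem : ∀ w : W, M.coact w ∈ LinearMap.range (W.subtype.rTensor A) := fun w =>
    (hex _).1 (by rw [lin_coact, show lin f w = 0 from w.2, map_zero])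
  have hact : ∀ a, ∀ w ∈ W, M.act a w ∈ W := fun a w hw => by
    rw [LinearMap.mem_ker] at hw ⊢
    rw [lin_act, hw, map_zero]
  let e := LinearEquiv.ofInjective (W.subtype.rTensor A) hj1
  let K : YDModule k A := M.ofInjective W
    (LinearMap.mk₂ k (fun a (w : W) => (⟨M.act a w, hact a w w.2⟩ : W))
      (fun a b w => by ext; simp) (fun c a w => by ext; simp) (fun a b w => by ext; simp)
      (fun c a w => by ext; simp))
    (e.symm.toLinearMap ∘ₗ (M.coact ∘ₗ W.subtype).codRestrict _ hmem)
    W.subtype W.injective_subtype (fun a v => rfl)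
    (fun v => congrArg Subtype.val (e.apply_symm_apply
      ((M.coact ∘ₗ W.subtype).codRestrict _ hmem v)))
  refine ⟨K, mkHom (M := K) (N := M) W.subtype (fun a v => rfl) (fun v => ?_), ?_, ?_⟩
  · exact congrArg Subtype.val (e.apply_symm_apply
      ((M.coact ∘ₗ W.subtype).codRestrict _ hmem v))
  · exact W.injective_subtype
  · exact W.range_subtype

lemma exists_cokernel {M N : YDModule k A} (f : M ⟶ N) :
    ∃ (Q : YDModule k A) (p : N ⟶ Q), Function.Surjective (lin p) ∧
      LinearMap.ker (lin p) = LinearMap.range (lin f) := by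
  let W := LinearMap.range (lin f)
  have hact : ∀ a, W ≤ LinearMap.ker (W.mkQ ∘ₗ N.act a) := by
    rintro a _ ⟨v, rfl⟩
    simp only [LinearMap.mem_ker, LinearMap.comp_apply, ← lin_act]
    simp [W]
  have hco : W ≤ LinearMap.ker (W.mkQ.rTensor A ∘ₗ N.coact) := by
    rintro _ ⟨v, rfl⟩
    have h0 : W.mkQ ∘ₗ lin f = 0 := by ext; simp [W]
    rw [LinearMap.mem_ker, LinearMap.comp_apply, ← lin_coact, ← LinearMap.comp_apply,
      ← LinearMap.rTensor_comp, h0]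
    simp
  let act' : A →ₗ[k] (N.carrier ⧸ W) →ₗ[k] (N.carrier ⧸ W) :=
    { toFun := fun a => W.liftQ (W.mkQ ∘ₗ N.act a) (hact a)
      map_add' := fun a b => by ext; simp
      map_smul' := fun c a => by ext; simp }
  let Q : YDModule k A := N.ofSurjective (N.carrier ⧸ W) act'
    (W.liftQ (W.mkQ.rTensor A ∘ₗ N.coact) hco) W.mkQ W.mkQ_surjective (fun a v => rfl)
    (fun v => rfl)
  exact ⟨Q, mkHom (M := N) (N := Q) W.mkQ (fun a v => rfl) (fun v => rfl), W.mkQ_surjective,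
    W.ker_mkQ⟩

open Limits

lemma injective_of_mono {M N : YDModule k A} (f : M ⟶ N) [Mono f] :
    Function.Injective (lin f) := by
  obtain ⟨K, i, -, hi2⟩ := exists_kernel f
  have h0 : i = 0 := by
    rw [← cancel_mono f, zero_comp]
    ext v
    exact (hi2.le ⟨v, rfl⟩ : lin i v ∈ LinearMap.ker (lin f))
  rw [← LinearMap.ker_eq_bot, ← hi2, h0, lin_zero, LinearMap.range_zero]

lemma surjective_of_epi {M N : YDModule k A} (f : M ⟶ N) [Epi f] :
    Function.Surjective (lin f) := by
  obtain ⟨Q, p, -, hp2⟩ := exists_cokernel f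
  have h0 : p = 0 := by
    rw [← cancel_epi f, comp_zero]
    ext v
    exact (hp2.ge ⟨v, rfl⟩ : lin f v ∈ LinearMap.ker (lin p))
  rw [← LinearMap.range_eq_top, ← hp2, h0, lin_zero, LinearMap.ker_zero]

lemma mono_of_injective {M N : YDModule k A} (f : M ⟶ N) (hf : Function.Injective (lin f)) :
    Mono f :=
  ⟨fun _ _ e => hom_ext (LinearMap.ext fun v => hf (LinearMap.congr_fun (congrArg lin e) v))⟩

lemma epi_of_surjective {M N : YDModule k A} (f : M ⟶ N) (hf : Function.Surjective (lin f)) :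
    Epi f :=
  ⟨fun _ _ e => hom_ext (LinearMap.ext fun v => by
    obtain ⟨v, rfl⟩ := hf v
    exact LinearMap.congr_fun (congrArg lin e) v)⟩

lemma comp_eq_zero {M N P : YDModule k A} {f : M ⟶ N} {g : N ⟶ P}
    (h : LinearMap.range (lin f) ≤ LinearMap.ker (lin g)) : f ≫ g = 0 :=
  hom_ext (LinearMap.ext fun v => h ⟨v, rfl⟩)

lemma range_le_ker {M N P : YDModule k A} {f : M ⟶ N} {g : N ⟶ P} (h : f ≫ g = 0) :
    LinearMap.range (lin f) ≤ LinearMap.ker (lin g) := by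
  rintro _ ⟨v, rfl⟩
  exact LinearMap.congr_fun (congrArg lin h) v

/-- An injective morphism is a kernel of any morphism with the appropriate kernel. -/
noncomputable def isLimitOfExact {M N P : YDModule k A} (f : M ⟶ N) (g : N ⟶ P)
    (hf : Function.Injective (lin f)) (h : LinearMap.range (lin f) = LinearMap.ker (lin g)) :
    IsLimit (KernelFork.ofι f (comp_eq_zero h.le)) :=
  haveI := mono_of_injective f hf
  KernelFork.IsLimit.ofι' f _ fun l hl =>
    have e := exists_lift f hf l ((range_le_ker hl).trans h.ge)
    ⟨e.choose, e.choose_spec⟩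

/-- A surjective morphism is a cokernel of any morphism with the appropriate range. -/
noncomputable def isColimitOfExact {M N P : YDModule k A} (f : M ⟶ N) (g : N ⟶ P)
    (hg : Function.Surjective (lin g)) (h : LinearMap.range (lin f) = LinearMap.ker (lin g)) :
    IsColimit (CokernelCofork.ofπ g (comp_eq_zero h.le)) :=
  haveI := epi_of_surjective g hg
  CokernelCofork.IsColimit.ofπ' g _ fun l hl =>
    have e := exists_desc g hg l (h.ge.trans (range_le_ker hl))
    ⟨e.choose, e.choose_spec⟩

instance : HasKernels (YDModule k A) where
  has_limit f := by
    obtain ⟨K, i, h1, h2⟩ := exists_kernel f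
    exact ⟨⟨⟨_, isLimitOfExact i f h1 h2⟩⟩⟩

instance : HasCokernels (YDModule k A) where
  has_colimit f := by
    obtain ⟨K, i, h1, h2⟩ := exists_cokernel f
    exact ⟨⟨⟨_, isColimitOfExact f i h1 h2.symm⟩⟩⟩

instance : IsNormalMonoCategory (YDModule k A) where
  normalMonoOfMono f _ := by
    obtain ⟨Q, p, -, h2⟩ := exists_cokernel f
    exact ⟨⟨Q, p, _, isLimitOfExact f p (injective_of_mono f) h2.symm⟩⟩

instance : IsNormalEpiCategory (YDModule k A) where
  normalEpiOfEpi f _ := by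
    obtain ⟨K, i, -, h2⟩ := exists_kernel f
    exact ⟨⟨K, i, _, isColimitOfExact i f (surjective_of_epi f) h2⟩⟩

/-- The zero Yetter-Drinfeld module. -/
def zero : YDModule k A where
  carrier := PUnit
  coact := 0
  coassoc := by simp
  counit_coact := by ext
  act := 0
  act_one := by ext
  act_mul _ _ := by ext
  coact_act _ v := by rw [Subsingleton.elim v 0]; simp

instance : HasZeroObject (YDModule k A) :=
  ⟨zero, ⟨fun M => ⟨⟨⟨0⟩, fun f => hom_ext (LinearMap.ext fun v => by
      rw [show v = 0 from rfl, map_zero, map_zero])⟩⟩,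
    fun M => ⟨⟨⟨0⟩, fun f => hom_ext (LinearMap.ext fun v => rfl)⟩⟩⟩⟩

/-- The coaction on the direct sum. -/
noncomputable abbrev prodCoact (M N : YDModule k A) :
    M.carrier × N.carrier →ₗ[k] (M.carrier × N.carrier) ⊗[k] A :=
  ((LinearMap.inl k M.carrier N.carrier).rTensor A ∘ₗ M.coact).coprod
    ((LinearMap.inr k M.carrier N.carrier).rTensor A ∘ₗ N.coact)

/-- The action on the direct sum. -/
noncomputable abbrev prodAct (M N : YDModule k A) :
    A →ₗ[k] M.carrier × N.carrier →ₗ[k] M.carrier × N.carrier :=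
  LinearMap.prodMapLinear k M.carrier N.carrier M.carrier N.carrier k ∘ₗ M.act.prod N.act

/-- The direct sum of two Yetter-Drinfeld modules. -/
noncomputable def prod (M N : YDModule k A) : YDModule k A where
  carrier := M.carrier × N.carrier
  coact := prodCoact M N
  coassoc := LinearMap.prod_ext
    (LinearMap.ext (coassoc_apply M (prodCoact M N) (LinearMap.inl k _ _) (by simp)))
    (LinearMap.ext (coassoc_apply N (prodCoact M N) (LinearMap.inr k _ _) (by simp)))
  counit_coact := LinearMap.prod_ext
    (LinearMap.ext (counit_apply M (prodCoact M N) (LinearMap.inl k _ _) (by simp)))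
    (LinearMap.ext (counit_apply N (prodCoact M N) (LinearMap.inr k _ _) (by simp)))
  act := prodAct M N
  act_one := by ext <;> simp [M.act_one, N.act_one]
  act_mul a b := by ext <;> simp [M.act_mul, N.act_mul]
  coact_act a v := by
    have h1 := coact_act_apply M (prodAct M N) (prodCoact M N) (LinearMap.inl k _ _)
      (by simp) (by simp) a v.1
    have h2 := coact_act_apply N (prodAct M N) (prodCoact M N) (LinearMap.inr k _ _)
      (by simp) (by simp) a v.2
    have hv : v = LinearMap.inl k _ _ v.1 + LinearMap.inr k _ _ v.2 := by simp
    rw [hv]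
    simp only [map_add, h1, h2]

lemma prodCoact_inl (M N : YDModule k A) (v : M.carrier) :
    (LinearMap.inl k M.carrier N.carrier).rTensor A (M.coact v) =
      prodCoact M N (LinearMap.inl k M.carrier N.carrier v) := by simp

lemma prodCoact_inr (M N : YDModule k A) (v : N.carrier) :
    (LinearMap.inr k M.carrier N.carrier).rTensor A (N.coact v) =
      prodCoact M N (LinearMap.inr k M.carrier N.carrier v) := by simp

lemma prodAct_inl (M N : YDModule k A) (a : A) (v : M.carrier) :
    LinearMap.inl k M.carrier N.carrier (M.act a v) =
      prodAct M N a (LinearMap.inl k M.carrier N.carrier v) := by simp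

lemma prodAct_inr (M N : YDModule k A) (a : A) (v : N.carrier) :
    LinearMap.inr k M.carrier N.carrier (N.act a v) =
      prodAct M N a (LinearMap.inr k M.carrier N.carrier v) := by simp

lemma fst_prodCoact (M N : YDModule k A) (v : M.carrier × N.carrier) :
    (LinearMap.fst k M.carrier N.carrier).rTensor A (prodCoact M N v) = M.coact v.1 := by
  simp only [LinearMap.coprod_apply, LinearMap.comp_apply, map_add]
  rw [← LinearMap.comp_apply (LinearMap.rTensor _ _), ← LinearMap.rTensor_comp,
    ← LinearMap.comp_apply (LinearMap.rTensor _ _) (LinearMap.rTensor _ _),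
    ← LinearMap.rTensor_comp]
  simp

lemma snd_prodCoact (M N : YDModule k A) (v : M.carrier × N.carrier) :
    (LinearMap.snd k M.carrier N.carrier).rTensor A (prodCoact M N v) = N.coact v.2 := by
  simp only [LinearMap.coprod_apply, LinearMap.comp_apply, map_add]
  rw [← LinearMap.comp_apply (LinearMap.rTensor _ _), ← LinearMap.rTensor_comp,
    ← LinearMap.comp_apply (LinearMap.rTensor _ _) (LinearMap.rTensor _ _),
    ← LinearMap.rTensor_comp]
  simp

/-- The biproduct structure on the direct sum. -/
noncomputable def prodBicone (M N : YDModule k A) : BinaryBicone M N where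
  pt := prod M N
  fst := mkHom (M := prod M N) (LinearMap.fst k _ _) (fun _ _ => rfl) (fst_prodCoact M N)
  snd := mkHom (M := prod M N) (LinearMap.snd k _ _) (fun _ _ => rfl) (snd_prodCoact M N)
  inl := mkHom (N := prod M N) (LinearMap.inl k _ _) (prodAct_inl M N) (prodCoact_inl M N)
  inr := mkHom (N := prod M N) (LinearMap.inr k _ _) (prodAct_inr M N) (prodCoact_inr M N)
  inl_fst := rfl
  inl_snd := rfl
  inr_fst := rfl
  inr_snd := rfl

instance : HasBinaryBiproducts (YDModule k A) where
  has_binary_biproduct M N := hasBinaryBiproduct_of_total (prodBicone M N) <|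
    hom_ext <| LinearMap.ext fun (v : M.carrier × N.carrier) =>
      show LinearMap.inl k M.carrier N.carrier v.1 + LinearMap.inr k M.carrier N.carrier v.2 = v by
        simp

noncomputable instance : Abelian (YDModule k A) where
  has_finite_products :=
    haveI : HasTerminal (YDModule k A) := HasZeroObject.hasTerminal
    hasFiniteProducts_of_has_binary_and_terminal

end YDModule


section Objects

variable {k A : Type u} [Field k] [Ring A] [HopfAlgebra k A]

/-- The action `(v ⊗ a) ← b = v ⊗ ab` on `V ⊗ A`. -/
noncomputable def freeAct (V : RightComodule k A) :
    A →ₗ[k] V.carrier ⊗[k] A →ₗ[k] V.carrier ⊗[k] A :=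
  LinearMap.lTensorHom V.carrier ∘ₗ (LinearMap.mul k A).flip

@[simp] lemma freeAct_tmul (V : RightComodule k A) (v : V.carrier) (a b : A) :
    freeAct V b (v ⊗ₜ[k] a) = v ⊗ₜ[k] (a * b) := rfl

/-- `V ↦ V ⊠ A`: the free Yetter-Drinfeld module on a right comodule `V`. The underlying space is
`V ⊗ A`, with `(v ⊗ a) ← b = v ⊗ ab` and coaction
`v ⊗ a ↦ v₍₀₎ ⊗ a₍₂₎ ⊗ S(a₍₁₎) v₍₁₎ a₍₃₎`. -/
noncomputable def RightComodule.free (V : RightComodule k A) : YDModule k A where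
  carrier := V.carrier ⊗[k] A
  coact := freeCoact V
  coassoc := freeCoact_coassoc V
  counit_coact := freeCoact_counit V
  act := freeAct V
  act_one := TensorProduct.ext' fun v a => by simp
  act_mul a b := TensorProduct.ext' fun v c => by simp [mul_assoc]
  coact_act b w := by
    induction w using TensorProduct.induction_on with
    | zero => simp
    | add x y hx hy => simp only [map_add, hx, hy]
    | tmul v a =>
      simp only [freeAct_tmul, freeCoact_tmul, comul₂_mul]
      exact twist_mul _ _ _ (fun a b v => by simp) _ _ _

/-- The trivial Yetter-Drinfeld module `k`: `v ← a = ε(a) v`, `v ↦ v ⊗ 1`. -/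
noncomputable def YDModule.unit : YDModule k A where
  carrier := k
  coact := (TensorProduct.mk k k A).flip 1
  coassoc := by ext; simp [Algebra.TensorProduct.one_def]
  counit_coact := by ext; simp
  act := (LinearMap.mul k k) ∘ₗ Coalgebra.counit
  act_one := by ext; simp
  act_mul a b := by ext; simp [mul_comm]
  coact_act a c := by
    have h (u : A ⊗[k] (A ⊗[k] A)) : twist ((LinearMap.mul k k) ∘ₗ Coalgebra.counit) u
        (c ⊗ₜ[k] (1 : A)) = c ⊗ₜ[k] (LinearMap.mul' k A ((HopfAlgebra.antipode k).rTensor A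
          (((TensorProduct.lid k A).toLinearMap ∘ₗ
            (Coalgebra.counit (R := k) (A := A)).rTensor A).lTensor A u))) := by
      induction u using TensorProduct.induction_on with
      | zero => simp
      | add x y hx hy => simp only [map_add, LinearMap.add_apply, hx, hy, tmul_add]
      | tmul a t =>
        induction t using TensorProduct.induction_on with
        | zero => simp
        | add x y hx hy => simp only [tmul_add, map_add, LinearMap.add_apply, hx, hy]
        | tmul b d => simp [TensorProduct.smul_tmul']
    have h2 : ((TensorProduct.lid k A).toLinearMap ∘ₗ
        (Coalgebra.counit (R := k) (A := A)).rTensor A) ∘ₗ Coalgebra.comul = LinearMap.id := by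
      rw [LinearMap.comp_assoc, Coalgebra.rTensor_counit_comp_comul]; ext; simp
    rw [LinearMap.flip_apply, LinearMap.flip_apply, TensorProduct.mk_apply, TensorProduct.mk_apply,
      h, comul₂, LinearMap.comp_apply (LinearMap.lTensor _ _), ← LinearMap.lTensor_comp_apply, h2,
      LinearMap.lTensor_id, LinearMap.id_apply, HopfAlgebra.mul_antipode_rTensor_comul_apply]
    simp [Algebra.algebraMap_eq_smul_one, TensorProduct.smul_tmul']

variable (k A) in
/-- The Yetter-Drinfeld modules `A^{⊠ n}`: `A^{⊠ 0} = k`, `A^{⊠ (n+1)} = A^{⊠ n} ⊠ A`. -/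
noncomputable def boxPow : ℕ → YDModule k A
  | 0 => YDModule.unit
  | n + 1 => (boxPow n).toRightComodule.free

/-- `t ⊗ a ∈ A^{⊠ (n+1)}` for `t ∈ A^{⊠ n}`. -/
noncomputable def boxTmul {n : ℕ} (t : (boxPow k A n).carrier) (a : A) :
    (boxPow k A (n + 1)).carrier :=
  (t ⊗ₜ[k] a : (boxPow k A n).carrier ⊗[k] A)

variable (k) in
/-- The element `a₁ ⊗ ⋯ ⊗ aₙ` of `A^{⊠ n}`. -/
noncomputable def boxPure : (n : ℕ) → (Fin n → A) → (boxPow k A n).carrier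
  | 0, _ => (1 : k)
  | n + 1, a => boxTmul (boxPure n (Fin.init a)) (a (Fin.last n))

/-- The map `v ⊗ a ↦ f(v) ← a` for a linear map `f : M → V`. -/
noncomputable def actMap {M : Type u} [AddCommGroup M] [Module k M] (V : YDModule k A) :
    (M →ₗ[k] V.carrier) →ₗ[k] (M ⊗[k] A →ₗ[k] V.carrier) :=
  (TensorProduct.lift.equiv (RingHom.id k) M A V.carrier).toLinearMap ∘ₗ
    LinearMap.llcomp k M V.carrier (A →ₗ[k] V.carrier) V.act.flip

@[simp] lemma actMap_tmul {M : Type u} [AddCommGroup M] [Module k M] (V : YDModule k A)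
    (f : M →ₗ[k] V.carrier) (v : M) (a : A) : actMap V f (v ⊗ₜ[k] a) = V.act a (f v) := by
  simp [actMap]

/-- A colinear map `f : M → V` induces the morphism `M ⊠ A → V`, `v ⊗ a ↦ f(v) ← a`. -/
noncomputable def freeLift (M : RightComodule k A) (V : YDModule k A) :
    M.colinearMaps V.toRightComodule →ₗ[k] (M.free ⟶ V) where
  toFun f := YDModule.mkHom (M := M.free) (actMap V f.1)
    (fun a w => by
      refine LinearMap.congr_fun (f := actMap V f.1 ∘ₗ freeAct M a)
        (g := V.act a ∘ₗ actMap V f.1) (TensorProduct.ext' fun v b => ?_) w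
      rw [LinearMap.comp_apply, LinearMap.comp_apply, freeAct_tmul, actMap_tmul, actMap_tmul,
        V.act_mul, LinearMap.comp_apply])
    (fun w => by
      refine LinearMap.congr_fun (f := (actMap V f.1).rTensor A ∘ₗ freeCoact M)
        (g := V.coact ∘ₗ actMap V f.1) (TensorProduct.ext' fun v b => ?_) w
      rw [LinearMap.comp_apply, LinearMap.comp_apply, freeCoact_tmul, actMap_tmul, V.coact_act,
        twist_naturality _ V.act f.1 (actMap V f.1) (fun a v => by simp),
        RightComodule.mem_colinearMaps.1 f.2])
  map_add' f g := YDModule.hom_ext (map_add (actMap V) f.1 g.1)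
  map_smul' c f := YDModule.hom_ext (map_smul (actMap V) c f.1)

/-- A colinear map `f : M → N` induces the morphism `f ⊗ id : M ⊠ A → N ⊠ A`. -/
noncomputable def freeMap {M N : RightComodule k A} (f : M.colinearMaps N) : M.free ⟶ N.free :=
  YDModule.mkHom (M := M.free) (N := N.free) (f.1.rTensor A)
    (fun a w => by
      refine LinearMap.congr_fun (f := f.1.rTensor A ∘ₗ freeAct M a)
        (g := freeAct N a ∘ₗ f.1.rTensor A) (TensorProduct.ext' fun v b => ?_) w
      rw [LinearMap.comp_apply, LinearMap.comp_apply, freeAct_tmul, LinearMap.rTensor_tmul,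
        LinearMap.rTensor_tmul, freeAct_tmul])
    (fun w => by
      refine LinearMap.congr_fun (f := (f.1.rTensor A).rTensor A ∘ₗ freeCoact M)
        (g := freeCoact N ∘ₗ f.1.rTensor A) (TensorProduct.ext' fun v b => ?_) w
      rw [LinearMap.comp_apply, LinearMap.comp_apply, freeCoact_tmul, LinearMap.rTensor_tmul,
        freeCoact_tmul, twist_naturality _ (TensorProduct.mk k N.carrier A).flip f.1 (f.1.rTensor A)
        (fun a v => by simp), RightComodule.mem_colinearMaps.1 f.2])

/-- The colinear map underlying a morphism of Yetter-Drinfeld modules. -/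
def YDModule.toColinear {M N : YDModule k A} :
    (M ⟶ N) →ₗ[k] M.colinearMaps N.toRightComodule where
  toFun f := ⟨lin f, f.2.2⟩
  map_add' _ _ := rfl
  map_smul' _ _ := rfl

/-- Precomposition of colinear maps with a morphism of Yetter-Drinfeld modules. -/
def YDModule.precomp {M N : YDModule k A} (g : M ⟶ N) (V : YDModule k A) :
    N.colinearMaps V.toRightComodule →ₗ[k] M.colinearMaps V.toRightComodule where
  toFun f := ⟨f.1 ∘ₗ lin g, RightComodule.mem_colinearMaps.2 fun v => by
    rw [LinearMap.rTensor_comp, LinearMap.comp_apply, lin_coact,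
      RightComodule.mem_colinearMaps.1 f.2, LinearMap.comp_apply]⟩
  map_add' _ _ := rfl
  map_smul' _ _ := rfl

/-- The morphism `A^{⊠ (n+1)} → V`, `t ⊗ a ↦ f(t) ← a`. -/
noncomputable def boxLift {n : ℕ} {V : YDModule k A} :
    (boxPow k A n).colinearMaps V.toRightComodule →ₗ[k] (boxPow k A (n + 1) ⟶ V) :=
  freeLift (boxPow k A n).toRightComodule V

/-- The morphism `f ⊗ id : A^{⊠ (m+1)} → A^{⊠ (n+1)}`. -/
noncomputable def boxMap {m n : ℕ} (f : boxPow k A m ⟶ boxPow k A n) :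
    boxPow k A (m + 1) ⟶ boxPow k A (n + 1) :=
  freeMap (YDModule.toColinear f)

variable (k A) in
/-- The morphism `A^{⊠ (n+1)} → A^{⊠ n}` given by
`a₁ ⊗ ⋯ ⊗ aₙ₊₁ ↦ ε(a₁) a₂ ⊗ ⋯ ⊗ aₙ₊₁ + ∑ᵢ (-1)ⁱ a₁ ⊗ ⋯ ⊗ aᵢ aᵢ₊₁ ⊗ ⋯ ⊗ aₙ₊₁`
(see `bar_boxPure`), defined by the recursion `bar (t ⊗ a) = bar t ⊗ a + (-1)ⁿ (t ← a)`. -/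
noncomputable def bar : (n : ℕ) → (boxPow k A (n + 1) ⟶ boxPow k A n)
  | 0 => boxLift (YDModule.toColinear (𝟙 (boxPow k A 0)))
  | n + 1 => boxMap (bar n) +
      (-1 : k) ^ (n + 1) • boxLift (YDModule.toColinear (𝟙 (boxPow k A (n + 1))))

/-- The differential `∂ : Hom^A(A^{⊠ n}, V) → Hom^A(A^{⊠ (n+1)}, V)`,
`(∂ f)(a₁ ⊗ ⋯ ⊗ aₙ₊₁) = ε(a₁) f(a₂ ⊗ ⋯ ⊗ aₙ₊₁) + ∑ᵢ (-1)ⁱ f(a₁ ⊗ ⋯ ⊗ aᵢ aᵢ₊₁ ⊗ ⋯ ⊗ aₙ₊₁)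
+ (-1)ⁿ⁺¹ f(a₁ ⊗ ⋯ ⊗ aₙ) ← aₙ₊₁`; see `diff_boxPure`. -/
noncomputable def diff (V : YDModule k A) (n : ℕ) :
    (boxPow k A n).colinearMaps V.toRightComodule →ₗ[k]
      (boxPow k A (n + 1)).colinearMaps V.toRightComodule :=
  YDModule.precomp (bar k A n) V + (-1 : k) ^ (n + 1) • YDModule.toColinear ∘ₗ boxLift

/-! ### Formulas -/

lemma box_ext {n : ℕ} {W : Type u} [AddCommGroup W] [Module k W]
    {f g : (boxPow k A (n + 1)).carrier →ₗ[k] W}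
    (h : ∀ (t : (boxPow k A n).carrier) (a : A), f (boxTmul t a) = g (boxTmul t a)) : f = g :=
  TensorProduct.ext' h

lemma act_boxTmul {n : ℕ} (t : (boxPow k A n).carrier) (a b : A) :
    (boxPow k A (n + 1)).act b (boxTmul t a) = boxTmul t (a * b) := rfl

lemma boxPure_succ (n : ℕ) (a : Fin (n + 1) → A) :
    boxPure k (n + 1) a = boxTmul (boxPure k n (Fin.init a)) (a (Fin.last n)) := rfl

lemma boxLift_boxTmul {n : ℕ} {V : YDModule k A}
    (f : (boxPow k A n).colinearMaps V.toRightComodule) (t : (boxPow k A n).carrier) (a : A) :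
    YDModule.lin (boxLift f) (boxTmul t a) = V.act a (f.1 t) :=
  actMap_tmul V f.1 t a

lemma zero_boxTmul {n : ℕ} (a : A) : boxTmul (0 : (boxPow k A n).carrier) a = 0 :=
  TensorProduct.zero_tmul _ a

lemma add_boxTmul {n : ℕ} (s t : (boxPow k A n).carrier) (a : A) :
    boxTmul (s + t) a = boxTmul s a + boxTmul t a :=
  TensorProduct.add_tmul s t a

lemma smul_boxTmul {n : ℕ} (c : k) (t : (boxPow k A n).carrier) (a : A) :
    boxTmul (c • t) a = c • boxTmul t a :=
  (TensorProduct.smul_tmul' c t a).symm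

lemma bar_zero_boxTmul (t : (boxPow k A 0).carrier) (a : A) :
    YDModule.lin (bar k A 0) (boxTmul t a) = (boxPow k A 0).act a t := by
  rw [bar, boxLift_boxTmul]; rfl

lemma bar_succ_boxTmul (n : ℕ) (t : (boxPow k A (n + 1)).carrier) (a : A) :
    YDModule.lin (bar k A (n + 1)) (boxTmul t a) =
      boxTmul (YDModule.lin (bar k A n) t) a +
        (-1 : k) ^ (n + 1) • (boxPow k A (n + 1)).act a t :=
  congrArg (fun x => boxTmul (YDModule.lin (bar k A n) t) a + (-1 : k) ^ (n + 1) • x)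
    (boxLift_boxTmul (YDModule.toColinear (𝟙 (boxPow k A (n + 1)))) t a)

lemma diff_boxTmul (V : YDModule k A) (n : ℕ)
    (f : (boxPow k A n).colinearMaps V.toRightComodule) (t : (boxPow k A n).carrier) (a : A) :
    (diff V n f).1 (boxTmul t a) = f.1 (YDModule.lin (bar k A n) (boxTmul t a)) +
      (-1 : k) ^ (n + 1) • V.act a (f.1 t) :=
  congrArg (fun x => f.1 (YDModule.lin (bar k A n) (boxTmul t a)) + (-1 : k) ^ (n + 1) • x)
    (boxLift_boxTmul f t a)

lemma diff_act (V : YDModule k A) (n : ℕ)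
    (f : (boxPow k A n).colinearMaps V.toRightComodule) (t : (boxPow k A (n + 1)).carrier) (a : A) :
    (diff V n f).1 ((boxPow k A (n + 1)).act a t) =
      f.1 ((boxPow k A n).act a (YDModule.lin (bar k A n) t)) +
      V.act a ((diff V n f).1 t - f.1 (YDModule.lin (bar k A n) t)) := by
  refine LinearMap.congr_fun (f := (diff V n f).1 ∘ₗ (boxPow k A (n + 1)).act a)
    (g := f.1 ∘ₗ (boxPow k A n).act a ∘ₗ YDModule.lin (bar k A n) +
      V.act a ∘ₗ ((diff V n f).1 - f.1 ∘ₗ YDModule.lin (bar k A n))) (box_ext fun t b => ?_) t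
  simp only [LinearMap.comp_apply, LinearMap.add_apply, LinearMap.sub_apply, diff_boxTmul,
    add_sub_cancel_left, ← YDModule.lin_act, act_boxTmul, V.act_mul, map_smul]

lemma bar_boxTmul_bar (n : ℕ) (h : ∀ m, n = m + 1 → ∀ t,
      YDModule.lin (bar k A m) (YDModule.lin (bar k A (m + 1)) t) = 0)
    (t : (boxPow k A (n + 1)).carrier) (a : A) :
    YDModule.lin (bar k A n) (boxTmul (YDModule.lin (bar k A n) t) a) =
      (-1 : k) ^ n • (boxPow k A n).act a (YDModule.lin (bar k A n) t) := by
  cases n with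
  | zero => rw [bar_zero_boxTmul, pow_zero, one_smul]
  | succ m =>
    rw [bar_succ_boxTmul, h m rfl, zero_boxTmul, zero_add]

lemma bar_bar (n : ℕ) (t : (boxPow k A (n + 2)).carrier) :
    YDModule.lin (bar k A n) (YDModule.lin (bar k A (n + 1)) t) = 0 := by
  induction n with
  | zero =>
    refine LinearMap.congr_fun (f := YDModule.lin (bar k A 0) ∘ₗ YDModule.lin (bar k A 1))
      (g := 0) (box_ext fun t a => ?_) t
    rw [LinearMap.comp_apply, bar_succ_boxTmul, map_add, map_smul,
      bar_boxTmul_bar _ (by intro m hm; omega), YDModule.lin_act]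
    simp
  | succ n ih =>
    refine LinearMap.congr_fun (f := YDModule.lin (bar k A (n + 1)) ∘ₗ
      YDModule.lin (bar k A (n + 2))) (g := 0) (box_ext fun t a => ?_) t
    rw [LinearMap.comp_apply, bar_succ_boxTmul, map_add, map_smul,
      bar_boxTmul_bar _ (by rintro m hm; obtain rfl : n = m := by omega
                            exact ih), YDModule.lin_act, ← add_smul]
    rw [pow_succ (-1 : k) (n + 1)]
    simp

lemma diff_diff (V : YDModule k A) (n : ℕ) (f : (boxPow k A n).colinearMaps V.toRightComodule) :
    diff V (n + 1) (diff V n f) = 0 := by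
  apply Subtype.ext
  refine box_ext fun t a => ?_
  rw [diff_boxTmul, bar_succ_boxTmul, map_add, map_smul, diff_act, diff_boxTmul,
    bar_boxTmul_bar n (by rintro m rfl; exact bar_bar m)]
  simp only [map_smul, map_sub, smul_add, smul_sub, pow_succ]
  simp
  abel

/-- The formula for `bar` on `a₁ ⊗ ⋯ ⊗ aₙ₊₁`. -/
lemma bar_boxPure (n : ℕ) (a : Fin (n + 1) → A) :
    YDModule.lin (bar k A n) (boxPure k (n + 1) a) =
      Coalgebra.counit (R := k) (a 0) • boxPure k n (Fin.tail a) +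
      ∑ i : Fin n, (-1 : k) ^ ((i : ℕ) + 1) •
        boxPure k n (Fin.contractNth i.castSucc (· * ·) a) := by
  induction n with
  | zero =>
    rw [boxPure_succ, bar_zero_boxTmul]
    simp only [Finset.univ_eq_empty, Finset.sum_empty, add_zero]
    rfl
  | succ n ih =>
    have e1 : boxTmul (boxPure k n (Fin.tail (Fin.init a))) (a (Fin.last (n + 1))) =
        boxPure k (n + 1) (Fin.tail a) := by
      rw [boxPure_succ, Fin.tail_init_eq_init_tail]; rfl
    have e2 (i : Fin n) : boxTmul (boxPure k n (Fin.contractNth i.castSucc (· * ·) (Fin.init a)))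
        (a (Fin.last (n + 1))) =
        boxPure k (n + 1) (Fin.contractNth i.castSucc.castSucc (· * ·) a) := by
      rw [boxPure_succ]
      congr 1
      rw [Fin.contractNth_apply_of_gt _ _ _ _ (by simp)]
      rfl
    have e3 : (boxPow k A (n + 1)).act (a (Fin.last (n + 1))) (boxPure k (n + 1) (Fin.init a)) =
        boxPure k (n + 1) (Fin.contractNth (Fin.last n).castSucc (· * ·) a) := by
      rw [boxPure_succ, act_boxTmul, boxPure_succ]
      congr 1
      · congr 1
        funext j
        simp only [Fin.init]
        rw [Fin.contractNth_apply_of_lt _ _ _ _ (by simp)]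
      · rw [Fin.contractNth_apply_of_eq _ _ _ _ (by simp)]
        rfl
    rw [Fin.sum_univ_castSucc, boxPure_succ, bar_succ_boxTmul, ih, e3, add_boxTmul, smul_boxTmul, e1,
      add_assoc]
    have e4 (F : Fin n → (boxPow k A n).carrier) (b : A) :
        boxTmul (∑ i, F i) b = ∑ i, boxTmul (F i) b :=
      TensorProduct.sum_tmul _ _ _
    simp only [e4, smul_boxTmul, e2]
    rfl

/-- The formula for `∂` on `a₁ ⊗ ⋯ ⊗ aₙ₊₁`. -/
lemma diff_boxPure (V : YDModule k A) (n : ℕ)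
    (f : (boxPow k A n).colinearMaps V.toRightComodule) (a : Fin (n + 1) → A) :
    (diff V n f).1 (boxPure k (n + 1) a) =
      Coalgebra.counit (R := k) (a 0) • f.1 (boxPure k n (Fin.tail a)) +
      ∑ i : Fin n, (-1 : k) ^ ((i : ℕ) + 1) •
        f.1 (boxPure k n (Fin.contractNth i.castSucc (· * ·) a)) +
      (-1 : k) ^ (n + 1) • V.act (a (Fin.last n)) (f.1 (boxPure k n (Fin.init a))) := by
  have h := diff_boxTmul V n f (boxPure k n (Fin.init a)) (a (Fin.last n))
  have h' := bar_boxPure (k := k) n a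
  rw [boxPure_succ] at h' ⊢
  rw [h, h']
  simp

end Objects


section Cohomology

variable {k A : Type u} [Field k] [Ring A] [HopfAlgebra k A]

/-- `V` is relative injective: `Hom(-, V)` transforms the exact sequences
`0 → X₁ → X₂ → X₃ → 0` of Yetter-Drinfeld modules that split as sequences of `A`-modules into
exact sequences `0 → Hom(X₃, V) → Hom(X₂, V) → Hom(X₁, V) → 0`. -/
def IsRelativeInjective (V : YDModule k A) : Prop :=
  ∀ S : ShortComplex (YDModule k A), S.ShortExact →
    (∃ r ∈ S.X₂.linearMaps S.X₁, r ∘ₗ YDModule.lin S.f = LinearMap.id) →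
    Function.Injective (fun h : S.X₃ ⟶ V => S.g ≫ h) ∧
    Function.Exact (fun h : S.X₃ ⟶ V => S.g ≫ h) (fun h : S.X₂ ⟶ V => S.f ≫ h) ∧
    Function.Surjective (fun h : S.X₂ ⟶ V => S.f ≫ h)

instance : HasExt.{u + 1} (YDModule k A) := HasExt.standard _

/-- The Gerstenhaber-Schack cohomology `H^n_GS(A, V)`, the Ext group `Ext^n(k, V)` in the category
of Yetter-Drinfeld modules. It is a vector space over `k`. -/
abbrev GSCohomology (V : YDModule k A) (n : ℕ) : Type (u + 1) :=
  Abelian.Ext.{u + 1} YDModule.unit V n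

/-- The complex `0 → Hom^A(k, V) → Hom^A(A^{⊠ 1}, V) → ⋯ → Hom^A(A^{⊠ n}, V) → ⋯`. -/
noncomputable def gsComplex (V : YDModule k A) : CochainComplex (ModuleCat.{u} k) ℕ :=
  CochainComplex.of
    (fun n => ModuleCat.of k ((boxPow k A n).colinearMaps V.toRightComodule))
    (fun n => ModuleCat.ofHom (diff V n))
    (fun n => by ext f : 2; exact diff_diff V n f)

end Cohomology

end GerstenhaberSchack

/-! The maps `bar` make `⋯ → A^{⊠ 2} → A^{⊠ 1} → k → 0` exact: `t ↦ t ⊗ 1` is a contraction up to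
sign (`ker_bar`). The functor `X ↦ X ⊠ A` is left adjoint to forgetting the action, so `Hom^A(A^{⊠
n}, V)` is the space of Yetter-Drinfeld morphisms `A^{⊠ (n+1)} → V` (`freeLiftEquiv`), and this
identification turns `∂` into precomposition with `bar` (`freeLiftEquiv_diff`). The complex of the
theorem is thus the complex of morphisms from the bar resolution of `k` to `V`. It computes `Ext(k,
V)` as soon as each free module `M ⊠ A` has no `Ext` into `V` in positive degrees
(`subsingleton_ext_free`); the passage is dimension shifting along the syzygies
(`exists_ker_leftComp_ext`).

Acyclicity has a different reason under each hypothesis. If `A` is cosemisimple, surjections of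
comodules split, so by the adjunction `M ⊠ A` is projective (`projective_free`).

If `V` is relative injective, `M ⊠ A` need not be projective, but it is free as an `A`-module. A
class of positive degree in `Ext(F, V)` dies on some epimorphism onto `F`
(`exists_epi_mk₀_comp_eq_zero`), which may be taken with free source, so the class is the image of a
class on the kernel under the connecting map. If `F` has the `A`-linear lifting property, the
extension splits over `A` and the kernel inherits the property. The degree thus drops until the
class comes from a morphism from a kernel to `V`; this morphism extends to the free module by
relative injectivity, so its connecting class is zero (`ext_eq_zero_of_isRelativeInjective`). -/

namespace GerstenhaberSchack

/-! ### Effaceability of Ext in the first variable. -/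

section Homological

open Limits DerivedCategory HomologicalComplex

universe w v u'

variable {C : Type u'} [Category.{v} C] [Abelian C]

/-- A quasi-isomorphism from a complex in degrees `≤ i` to an object in degree `i` is dominated
by an epimorphism of objects. -/
lemma exists_epi_factor_of_quasiIsoAt {P : C} {K : CochainComplex C ℤ} {i : ℤ}
    (π : K ⟶ (single C (ComplexShape.up ℤ) i).obj P) [K.IsStrictlyLE i] (hπ : QuasiIsoAt π i) :
    ∃ (p : K.X i ⟶ P) (s : (single C (ComplexShape.up ℤ) i).obj (K.X i) ⟶ K), Epi p ∧
      s ≫ π = (single C (ComplexShape.up ℤ) i).map p := by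
  -- The differential leaving degree `i` has zero target, so every element of `K.X i` is a cycle;
  -- hence `p` is the projection to homology followed by isomorphisms, which makes it epi.
  let e := K.iCyclesIso i (i + 1) (by simp)
    ((K.isZero_of_isStrictlyLE i (i + 1) (by simp)).eq_of_tgt _ _)
  let p : K.X i ⟶ P := π.f i ≫ (singleObjXSelf (ComplexShape.up ℤ) i P).hom
  have hp : p = e.inv ≫ K.homologyπ i ≫ homologyMap π i ≫
      (singleObjHomologySelfIso _ _ _).hom := by
    rw [← cancel_epi e.hom]
    dsimp [p, e]
    rw [Iso.hom_inv_id_assoc, homologyπ_naturality_assoc,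
      homologyπ_singleObjHomologySelfIso_hom, singleObjCyclesSelfIso_hom, cyclesMap_i_assoc]
    rfl
  refine ⟨p, mkHomFromSingle (𝟙 (K.X i)) (by
    rintro _ rfl
    apply (K.isZero_of_isStrictlyLE i (i + 1) (by simp)).eq_of_tgt), ?_, ?_⟩
  · rw [hp]
    infer_instance
  · apply HomologicalComplex.from_single_hom_ext
    rw [comp_f, mkHomFromSingle_f, single_map_f_self]
    simp [p]

/-- Write `φ` as a roof `P ← K → L` with `K` in degrees `≤ i`. After pulling back to `K.X i`, the
left leg is inverted by the chain map `s`, and what remains is an honest chain map from an object in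
degree `i` to a complex that vanishes there. -/
lemma exists_epi_map_comp_eq_zero [HasDerivedCategory.{w} C] {P : C} {L : CochainComplex C ℤ}
    {i : ℤ} (φ : Q.obj ((CochainComplex.singleFunctor C i).obj P) ⟶ Q.obj L)
    (n : ℤ) (hn : n < i) [L.IsStrictlyLE n] :
    ∃ (Z : C) (p : Z ⟶ P), Epi p ∧ Q.map ((CochainComplex.singleFunctor C i).map p) ≫ φ = 0 := by
  obtain ⟨K, _, π, h, g, rfl⟩ := right_fac_of_isStrictlyLE φ i
  have hq : QuasiIso π := by rwa [isIso_Q_map_iff_quasiIso] at h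
  obtain ⟨p, s, hp, hs⟩ : ∃ (p : K.X i ⟶ P)
      (s : (CochainComplex.singleFunctor C i).obj (K.X i) ⟶ K), Epi p ∧
      s ≫ π = (CochainComplex.singleFunctor C i).map p :=
    exists_epi_factor_of_quasiIsoAt π (hq.quasiIsoAt i)
  refine ⟨K.X i, p, hp, ?_⟩
  have h₂ : s ≫ g = 0 := by
    apply HomologicalComplex.from_single_hom_ext
    apply (L.isZero_of_isStrictlyLE n i hn).eq_of_tgt
  rw [← hs, Q.map_comp, Category.assoc, IsIso.hom_inv_id_assoc, ← Q.map_comp, h₂, Q.map_zero]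

/-- Classes of positive degree are effaceable in the first variable. -/
lemma exists_epi_mk₀_comp_eq_zero [HasExt.{w} C] {X Y : C} {n : ℕ}
    (e : Abelian.Ext.{w} X Y (n + 1)) :
    ∃ (Z : C) (p : Z ⟶ X), Epi p ∧ (Abelian.Ext.mk₀ p).comp e (zero_add _) = 0 := by
  let := HasDerivedCategory.standard C
  obtain ⟨Z, p, hp, h⟩ := exists_epi_map_comp_eq_zero
    -- A class of degree `n + 1` is a morphism to the shift of `Y`, that is, to `Y` placed in degree
    -- `-(n + 1)`, which is strictly below the degree `0` of `X`.
    (L := (CochainComplex.singleFunctor C (-(n + 1))).obj Y) (i := 0)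
    (e.hom ≫ ((singleFunctors C).shiftIso (n + 1) (-(n + 1)) 0 (by lia)).hom.app _)
    (-(n + 1)) (by lia)
  refine ⟨Z, p, hp, ?_⟩
  apply Abelian.Ext.homEquiv.injective
  rw [← cancel_mono (((singleFunctors C).shiftIso (n + 1) (-(n + 1)) 0 (by lia)).hom.app _)]
  change ((Abelian.Ext.mk₀ p).comp e (zero_add _)).hom ≫ _ = Abelian.Ext.hom 0 ≫ _
  rw [Abelian.Ext.zero_hom, Limits.zero_comp, ← Abelian.Ext.singleFunctor_map_comp_hom,
    Category.assoc]
  exact h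

end Homological

/-! ### Dimension shifting along an acyclic resolution. -/

section DimensionShift

open Limits Abelian

universe w v u' t

variable {C : Type u'} [Category.{v} C] [Abelian C] [HasExt.{w} C]
  (R : Type t) [CommRing R] [Linear R C]

/-- Precomposition with a morphism, on Ext groups. -/
noncomputable def extPrecomp {X Y : C} {a : ℕ} (α : Ext.{w} X Y a) (V : C) {b c : ℕ}
    (h : a + b = c) : Ext.{w} Y V b →ₗ[R] Ext.{w} X V c :=
  Ext.bilinearCompOfLinear R X Y V a b c h α

lemma extPrecomp_apply {X Y : C} {a : ℕ} (α : Ext.{w} X Y a) (V : C) {b c : ℕ}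
    (h : a + b = c) (β : Ext.{w} Y V b) : extPrecomp R α V h β = α.comp β h := rfl

/-- Isomorphic objects have isomorphic Ext groups. -/
noncomputable def extCongrLeft {X Y : C} (e : X ≅ Y) (V : C) (n : ℕ) :
    Ext.{w} Y V n ≃ₗ[R] Ext.{w} X V n :=
  LinearEquiv.ofLinearMap (extPrecomp R (Ext.mk₀ e.hom) V (zero_add n))
    (extPrecomp R (Ext.mk₀ e.inv) V (zero_add n))
    (LinearMap.ext fun x => by simp [extPrecomp_apply])
    (LinearMap.ext fun x => by simp [extPrecomp_apply])

/-- The connecting map is an isomorphism if the middle term is acyclic. -/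
lemma nonempty_ext_dimension_shift {S : ShortComplex C} (hS : S.ShortExact) (V : C)
    (hV : ∀ n, Subsingleton (Ext.{w} S.X₂ V (n + 1))) (n : ℕ) :
    Nonempty (Ext.{w} S.X₁ V (n + 1) ≃ₗ[R] Ext.{w} S.X₃ V (n + 2)) := by
  refine ⟨LinearEquiv.ofBijective (extPrecomp R hS.extClass V (by lia)) ⟨?_, fun x => ?_⟩⟩
  -- Injectivity uses the vanishing in degree `n + 1`, surjectivity that in degree `n + 2`. Starting
  -- from degree `0` the map need not be injective, since `Hom(S.X₂, V)` need not vanish; hence the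
  -- separate treatment of degree one.
  · rw [← LinearMap.ker_eq_bot, LinearMap.ker_eq_bot']
    intro x hx
    obtain ⟨y, rfl⟩ := Ext.contravariant_sequence_exact₁ hS V x (by lia) hx
    rw [Subsingleton.elim y 0, Ext.comp_zero]
  · exact Ext.contravariant_sequence_exact₃ hS V x (Subsingleton.elim _ _) (by lia)

/-- The connecting map in degree one. -/
lemma exists_hom_ext_one {S : ShortComplex C} (hS : S.ShortExact) (V : C)
    (hV : Subsingleton (Ext.{w} S.X₂ V 1)) :
    ∃ φ : (S.X₁ ⟶ V) →ₗ[R] Ext.{w} S.X₃ V 1, Function.Surjective φ ∧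
      ∀ f, φ f = 0 ↔ ∃ g, S.f ≫ g = f := by
  refine ⟨extPrecomp R hS.extClass V (add_zero 1) ∘ₗ
    (Ext.linearEquiv₀ (R := R)).symm.toLinearMap, fun x => ?_, fun f => ⟨fun h => ?_, ?_⟩⟩
  · obtain ⟨y, hy⟩ := Ext.contravariant_sequence_exact₃ hS V x (Subsingleton.elim _ _) (add_zero 1)
    exact ⟨Ext.linearEquiv₀ (R := R) y, by simpa [extPrecomp_apply] using hy⟩
  · obtain ⟨y, hy⟩ := Ext.contravariant_sequence_exact₁ hS V (Ext.mk₀ f) (add_zero 1) h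
    obtain ⟨g, rfl⟩ := (Ext.mk₀_bijective _ _).2 y
    rw [Ext.mk₀_comp_mk₀] at hy
    exact ⟨g, (Ext.mk₀_bijective _ _).1 hy⟩
  · rintro ⟨g, rfl⟩
    change hS.extClass.comp (Ext.mk₀ (S.f ≫ g)) (add_zero 1) = 0
    rw [← Ext.mk₀_comp_mk₀, hS.extClass_comp_assoc]

/-- Morphisms out of the cokernel `S.X₃` of `q ≫ S.f` with `q` an epimorphism. -/
noncomputable def homEquivKer {S : ShortComplex C} {Z : C} (q : Z ⟶ S.X₁) [Epi q]
    (hS : S.ShortExact) (V : C) :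
    (S.X₃ ⟶ V) ≃ₗ[R] LinearMap.ker (Linear.leftComp R V (q ≫ S.f)) :=
  have := hS.epi_g
  LinearEquiv.ofBijective
    ((Linear.leftComp R V S.g).codRestrict _ fun f => by simp)
    ⟨fun f g h => by
      have := congrArg Subtype.val h
      simpa [cancel_epi] using this, fun x => by
      have hx : (q ≫ S.f) ≫ x.1 = 0 := x.2
      rw [Category.assoc] at hx
      exact ⟨hS.exact.desc x.1 (zero_of_epi_comp _ hx), Subtype.ext (hS.exact.g_desc _ _)⟩⟩

/-- Let `⋯ → X 2 → X 1 → X 0` be an exact complex with syzygies `K n`, whose terms `X (n + 1)` are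
acyclic for `Ext(-, V)`. Then `Ext(K m, V)` is the cohomology of `Hom(X (• + 1), V)`. -/
lemma exists_ker_leftComp_ext {X K : ℕ → C} (p : ∀ n, X (n + 1) ⟶ K n) (i : ∀ n, K n ⟶ X n)
    (w : ∀ n, i (n + 1) ≫ p n = 0) (hS : ∀ n, (ShortComplex.mk _ _ (w n)).ShortExact) (V : C)
    (hV : ∀ m n, Subsingleton (Ext.{w} (X (m + 1)) V (n + 1))) (n : ℕ) : ∀ m j : ℕ, m + n = j →
    ∃ φ : LinearMap.ker (Linear.leftComp R V (p (j + 2) ≫ i (j + 2))) →ₗ[R]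
        Ext.{w} (K m) V (n + 1),
      Function.Surjective φ ∧ ∀ x, φ x = 0 ↔ ∃ g, (p (j + 1) ≫ i (j + 1)) ≫ g = x.1 := by
  induction n with
  | zero =>
    rintro m _ rfl
    have := (hS (m + 1)).epi_g
    have := (hS (m + 2)).epi_g
    -- `Ext¹(K m, V)` is `Hom(K (m+1), V)` modulo the maps that extend to `X (m+1)`, and `θ`
    -- identifies `Hom(K (m+1), V)` with the cocycles in `Hom(X (m+2), V)`.
    obtain ⟨φ, hφ, hφ'⟩ := exists_hom_ext_one R (hS m) V (hV m 0)
    let θ := homEquivKer R (p (m + 2)) (hS (m + 1)) V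
    refine ⟨φ ∘ₗ θ.symm.toLinearMap, hφ.comp θ.symm.surjective, fun x => ?_⟩
    obtain ⟨f, rfl⟩ := θ.surjective x
    rw [LinearMap.comp_apply, LinearEquiv.coe_coe, LinearEquiv.symm_apply_apply, hφ']
    refine exists_congr fun g => ?_
    change _ ↔ (p (m + 1) ≫ i (m + 1)) ≫ g = p (m + 1) ≫ f
    rw [Category.assoc, cancel_epi]
  | succ n ih =>
    rintro m j h
    -- The shift replaces `K m` by `K (m+1)` and lowers the degree by one, so `m + n` is unchanged.
    -- Keeping this sum as a variable `j` leaves the cocycle space literally the same throughout the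
    -- induction.
    obtain ⟨φ, hφ, hφ'⟩ := ih (m + 1) j (by lia)
    obtain ⟨e⟩ := nonempty_ext_dimension_shift R (hS m) V (hV m) n
    exact ⟨e.toLinearMap ∘ₗ φ, e.surjective.comp hφ, fun x => by simpa using hφ' x⟩

end DimensionShift

/-! ### Free Yetter-Drinfeld modules are acyclic for `Ext(-, V)`. -/

section Acyclic

variable {k A : Type u} [Field k] [Ring A] [HopfAlgebra k A]

lemma YDModule.shortExact {S : ShortComplex (YDModule k A)}
    (hf : Function.Injective (YDModule.lin S.f)) (hg : Function.Surjective (YDModule.lin S.g))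
    (h : LinearMap.range (YDModule.lin S.f) = LinearMap.ker (YDModule.lin S.g)) :
    S.ShortExact where
  mono_f := YDModule.mono_of_injective _ hf
  epi_g := YDModule.epi_of_surjective _ hg
  exact :=
    have := YDModule.mono_of_injective _ hf
    S.exact_of_f_is_kernel (YDModule.isLimitOfExact S.f S.g hf h)

lemma freeLift_tmul {M : RightComodule k A} {V : YDModule k A}
    (f : M.colinearMaps V.toRightComodule) (v : M.carrier) (a : A) :
    YDModule.lin (freeLift M V f) (v ⊗ₜ[k] a : M.carrier ⊗[k] A) = V.act a (f.1 v) :=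
  actMap_tmul V f.1 v a

/-- Here `1 ⊗ (1 ⊗ 1)` is the iterated coproduct of `1`, so this is the colinearity of `v ↦ v ⊗ 1`.
-/
lemma rTensor_mk_one {W : Type u} [AddCommGroup W] [Module k W] (x : W ⊗[k] A) :
    ((TensorProduct.mk k W A).flip 1).rTensor A x =
      twist (TensorProduct.mk k W A).flip (1 ⊗ₜ[k] (1 ⊗ₜ[k] 1)) x := by
  induction x using TensorProduct.induction_on with
  | zero => simp
  | add x y hx hy => rw [map_add, map_add, hx, hy]
  | tmul x a => simp

/-- The colinear map `v ↦ v ⊗ 1`. -/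
noncomputable def freeUnit (M : RightComodule k A) : M.colinearMaps M.free.toRightComodule :=
  ⟨(TensorProduct.mk k M.carrier A).flip 1, RightComodule.mem_colinearMaps.2 fun v => by
    refine (rTensor_mk_one (M.coact v)).trans ?_
    rw [← comul₂_one]
    exact (freeCoact_tmul M v 1).symm⟩

lemma act_freeUnit (M : RightComodule k A) (v : M.carrier) (a : A) :
    M.free.act a ((freeUnit M).1 v) = (v ⊗ₜ[k] a : M.carrier ⊗[k] A) :=
  (freeAct_tmul M v 1 a).trans (by rw [one_mul])

/-- The adjunction between the free Yetter-Drinfeld module and the underlying comodule. -/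
noncomputable def freeLiftEquiv (M : RightComodule k A) (V : YDModule k A) :
    M.colinearMaps V.toRightComodule ≃ₗ[k] (M.free ⟶ V) :=
  LinearEquiv.ofBijective (freeLift M V)
    ⟨fun f g h => Subtype.ext <| LinearMap.ext fun v => by
      have := LinearMap.congr_fun (congrArg YDModule.lin h) (v ⊗ₜ[k] (1 : A) : M.carrier ⊗[k] A)
      simpa only [freeLift_tmul, V.act_one, LinearMap.id_apply] using this,
    fun g => ⟨⟨YDModule.lin g ∘ₗ (freeUnit M).1, RightComodule.mem_colinearMaps.2 fun v => by
        rw [LinearMap.rTensor_comp, LinearMap.comp_apply,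
          RightComodule.mem_colinearMaps.1 (freeUnit M).2, YDModule.lin_coact]; rfl⟩,
      YDModule.hom_ext <| TensorProduct.ext' fun v a => by
        refine (freeLift_tmul _ v a).trans ?_
        rw [LinearMap.comp_apply, ← YDModule.lin_act, act_freeUnit]
        rfl⟩⟩

/-- The counit `M ⊠ A → M` of the adjunction. -/
noncomputable def freeCounit (M : YDModule k A) : M.toRightComodule.free ⟶ M :=
  freeLift M.toRightComodule M (YDModule.toColinear (𝟙 M))

lemma freeCounit_surjective (M : YDModule k A) : Function.Surjective (YDModule.lin (freeCounit M)) :=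
  fun v => ⟨(v ⊗ₜ[k] 1 : M.carrier ⊗[k] A), by
    rw [freeCounit, freeLift_tmul, M.act_one]; rfl⟩

/-! ### Cosemisimple Hopf algebras -/

/-- The kernel is the image of a morphism of Yetter-Drinfeld modules, and colinearity puts the
coaction of an image element in `image ⊗ A`. -/
lemma YDModule.isSubcomodule_ker {M N : YDModule k A} (p : M ⟶ N) :
    M.IsSubcomodule (LinearMap.ker (lin p)) := by
  obtain ⟨K, i, -, hi⟩ := exists_kernel p
  rw [← hi]
  rintro _ ⟨v, rfl⟩
  rw [← lin_coact]
  have : lin i = (LinearMap.range (lin i)).subtype ∘ₗ (lin i).rangeRestrict := rfl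
  rw [this, LinearMap.rTensor_comp]
  exact ⟨_, rfl⟩

/-- Over a cosemisimple Hopf algebra, surjections of comodules split. -/
lemma exists_colinear_section (h : IsCosemisimple k A) {M N : YDModule k A} (p : M ⟶ N)
    (hp : Function.Surjective (YDModule.lin p)) :
    ∃ s ∈ N.colinearMaps M.toRightComodule, YDModule.lin p ∘ₗ s = LinearMap.id := by
  obtain ⟨W, hW, hc⟩ := h M.toRightComodule _ (YDModule.isSubcomodule_ker p)
  have hb : Function.Bijective (YDModule.lin p ∘ₗ W.subtype) := by
    refine ⟨?_, fun y => ?_⟩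
    · rw [← LinearMap.ker_eq_bot, LinearMap.ker_eq_bot']
      intro x hx
      exact Subtype.ext (Submodule.disjoint_def.1 hc.disjoint x.1 hx x.2)
    · obtain ⟨x, rfl⟩ := hp y
      obtain ⟨a, ha, b, hb, rfl⟩ := Submodule.mem_sup.1 (hc.sup_eq_top ▸ Submodule.mem_top (x := x))
      refine ⟨⟨b, hb⟩, ?_⟩
      rw [map_add, LinearMap.mem_ker.1 ha, zero_add]
      rfl
  let e := LinearEquiv.ofBijective _ hb
  have he : YDModule.lin p ∘ₗ W.subtype ∘ₗ e.symm.toLinearMap = LinearMap.id :=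
    LinearMap.ext e.apply_symm_apply
  refine ⟨W.subtype ∘ₗ e.symm.toLinearMap, RightComodule.mem_colinearMaps.2 fun v => ?_, he⟩
  -- The complement `W` carries no coaction of its own, only the containment `hW`. The element `y`
  -- of `W ⊗ A` is recognised as the expected one after applying the injective map `p|_W ⊗ A`.
  obtain ⟨y, hy⟩ := hW (e.symm v) (e.symm v).2
  have hinj : Function.Injective ((YDModule.lin p ∘ₗ W.subtype).rTensor A) :=
    Module.Flat.rTensor_preserves_injective_linearMap _ hb.1
  have key : e.symm.toLinearMap.rTensor A (N.coact v) = y := by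
    apply hinj
    rw [← LinearMap.comp_apply (LinearMap.rTensor _ _), ← LinearMap.rTensor_comp,
      LinearMap.comp_assoc, he, LinearMap.rTensor_id, LinearMap.id_apply, LinearMap.rTensor_comp,
      LinearMap.comp_apply, hy, YDModule.lin_coact]
    exact congrArg N.coact (LinearMap.congr_fun he v).symm
  rw [LinearMap.rTensor_comp, LinearMap.comp_apply, key, hy]
  rfl

/-- By the adjunction, a lifting problem for `M ⊠ A` is one for colinear maps out of `M`, and a
colinear section of the epimorphism solves it. The section need not be `A`-linear. -/
lemma projective_free (h : IsCosemisimple k A) (M : RightComodule k A) : Projective M.free where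
  factors {E F} f p _ := by
    obtain ⟨s, hs, hps⟩ := exists_colinear_section h p (YDModule.surjective_of_epi p)
    obtain ⟨g, rfl⟩ := (freeLiftEquiv M F).surjective f
    refine ⟨freeLift M E ⟨s ∘ₗ g.1, RightComodule.mem_colinearMaps.2 fun v => ?_⟩,
      YDModule.hom_ext <| TensorProduct.ext' fun v a => ?_⟩
    · rw [LinearMap.rTensor_comp, LinearMap.comp_apply, RightComodule.mem_colinearMaps.1 g.2,
        RightComodule.mem_colinearMaps.1 hs]
      rfl
    · refine Eq.trans (congrArg (YDModule.lin p) (freeLift_tmul _ v a)) ?_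
      refine Eq.trans ?_ (freeLift_tmul g v a).symm
      rw [YDModule.lin_act]
      exact congrArg (F.act a) (LinearMap.congr_fun hps (g.1 v))

/-! ### Relative injective coefficients -/

/-- `F` has the lifting property of projective `A`-modules with respect to surjective morphisms of
Yetter-Drinfeld modules. -/
def IsRelativeProjective (F : YDModule k A) : Prop :=
  ∀ (M N : YDModule k A) (g : M ⟶ N), Function.Surjective (YDModule.lin g) →
    ∀ f ∈ F.linearMaps N, ∃ s ∈ F.linearMaps M, YDModule.lin g ∘ₗ s = f

/-- As an `A`-module, `M ⊠ A` is free on the space `M ⊗ 1`. A lift is therefore determined by an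
arbitrary `k`-linear lift on that space, which exists because `k` is a field. -/
lemma isRelativeProjective_free (M : RightComodule k A) : IsRelativeProjective M.free := by
  intro P N g hg f hf
  obtain ⟨s, hs⟩ := (YDModule.lin g).exists_rightInverse_of_surjective (LinearMap.range_eq_top.2 hg)
  let l : M.carrier →ₗ[k] P.carrier := s ∘ₗ f ∘ₗ (freeUnit M).1
  refine ⟨actMap P l, fun a w => ?_, TensorProduct.ext' fun v a => ?_⟩
  · refine LinearMap.congr_fun (f := actMap P l ∘ₗ freeAct M a)
        (g := P.act a ∘ₗ actMap P l) (TensorProduct.ext' fun v b => ?_) w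
    rw [LinearMap.comp_apply, LinearMap.comp_apply, freeAct_tmul, actMap_tmul, actMap_tmul,
        P.act_mul, LinearMap.comp_apply]
  · refine (congrArg (YDModule.lin g) (actMap_tmul P l v a)).trans ?_
    have h1 : YDModule.lin g (l v) = f ((freeUnit M).1 v) := LinearMap.congr_fun hs _
    rw [YDModule.lin_act, h1, ← hf, act_freeUnit]
    rfl

/-- A short exact sequence with relative projective quotient splits over `A`. -/
lemma exists_retraction {S : ShortComplex (YDModule k A)} (hS : S.ShortExact)
    (h : IsRelativeProjective S.X₃) :
    ∃ r ∈ S.X₂.linearMaps S.X₁, r ∘ₗ YDModule.lin S.f = LinearMap.id := by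
  have := hS.mono_f
  have := hS.epi_g
  have hi := YDModule.injective_of_mono S.f
  obtain ⟨s, hs, hgs⟩ := h _ _ S.g (YDModule.surjective_of_epi S.g) LinearMap.id (fun _ _ => rfl)
  obtain ⟨K, i, hi', hK⟩ := YDModule.exists_kernel S.g
  -- Categorical exactness is turned into equality of subspaces by lifting the concrete kernel `K`
  -- through `S.f`.
  have hfK : LinearMap.range (YDModule.lin S.f) = LinearMap.ker (YDModule.lin S.g) := by
    refine le_antisymm (YDModule.range_le_ker S.zero) ?_
    rw [← hK]
    have hiz : i ≫ S.g = 0 := YDModule.comp_eq_zero hK.le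
    rintro _ ⟨v, rfl⟩
    refine ⟨YDModule.lin (hS.exact.lift i hiz) v, ?_⟩
    exact LinearMap.congr_fun (congrArg YDModule.lin (hS.exact.lift_f i hiz)) v
  let e := LinearEquiv.ofInjective (YDModule.lin S.f) hi
  -- The projection `x ↦ x - s (g x)` along the `A`-linear section `s` lands in the kernel, and
  -- gives the retraction.
  have hmem : ∀ x, x - s (YDModule.lin S.g x) ∈ LinearMap.range (YDModule.lin S.f) := fun x => by
    rw [hfK, LinearMap.mem_ker, map_sub]
    exact sub_eq_zero.2 (LinearMap.congr_fun hgs _).symm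
  let r : S.X₂.carrier →ₗ[k] S.X₁.carrier := e.symm.toLinearMap ∘ₗ
    (LinearMap.id - s ∘ₗ YDModule.lin S.g).codRestrict _ hmem
  have hr : ∀ x, YDModule.lin S.f (r x) = x - s (YDModule.lin S.g x) := fun x =>
    congrArg Subtype.val (e.apply_symm_apply ⟨_, hmem x⟩)
  refine ⟨r, fun a v => hi ?_, LinearMap.ext fun v => hi ?_⟩
  · rw [hr, YDModule.lin_act, hs, YDModule.lin_act, hr, map_sub]
  · have hz : YDModule.lin S.g (YDModule.lin S.f v) = 0 := YDModule.range_le_ker S.zero ⟨v, rfl⟩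
    rw [LinearMap.comp_apply, hr, hz, map_zero, sub_zero]
    rfl

/-- Relative projectivity passes to kernels. -/
lemma IsRelativeProjective.of_shortExact {S : ShortComplex (YDModule k A)} (hS : S.ShortExact)
    (h₂ : IsRelativeProjective S.X₂) (h₃ : IsRelativeProjective S.X₃) :
    IsRelativeProjective S.X₁ := by
  obtain ⟨r, hr, hrf⟩ := exists_retraction hS h₃
  intro M N g hg f hf
  -- The `A`-linear retraction `r` extends `f` to the middle term, where a lift exists; its
  -- restriction to `S.X₁` lifts `f`.
  obtain ⟨s, hs, hgs⟩ := h₂ M N g hg (f ∘ₗ r) fun a v => by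
    rw [LinearMap.comp_apply, hr, hf]; rfl
  refine ⟨s ∘ₗ YDModule.lin S.f, fun a v => ?_, ?_⟩
  · rw [LinearMap.comp_apply, YDModule.lin_act, hs]; rfl
  · rw [← LinearMap.comp_assoc, hgs, LinearMap.comp_assoc, hrf, LinearMap.comp_id]

/-- The statement ranges over all relative projective `F`, not only free ones, because the induction
passes to the kernel of a free cover, which is relative projective but not visibly free. The class
comes from the kernel by the connecting map; in degree one it comes from a morphism, and relative
injectivity applies. -/
lemma ext_eq_zero_of_isRelativeInjective {V : YDModule k A} (hV : IsRelativeInjective V) (n : ℕ) :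
    ∀ {F : YDModule k A}, IsRelativeProjective F →
      ∀ e : Abelian.Ext.{u + 1} F V (n + 1), e = 0 := by
  induction n with
  | zero =>
    intro F hF e
    obtain ⟨Z, q, hq, hqe⟩ := exists_epi_mk₀_comp_eq_zero e
    -- Composing `q` with `Z ⊠ A → Z` still kills `e` and makes the middle term free.
    have : Epi (freeCounit Z) := YDModule.epi_of_surjective _ (freeCounit_surjective Z)
    let S : ShortComplex (YDModule k A) := ShortComplex.mk _ _
      (Limits.kernel.condition (freeCounit Z ≫ q))
    have hS : S.ShortExact := { exact := ShortComplex.exact_kernel _ }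
    obtain ⟨x, rfl⟩ := Abelian.Ext.contravariant_sequence_exact₃ hS V e (by
      change (Abelian.Ext.mk₀ (freeCounit Z ≫ q)).comp e _ = 0
      rw [← Abelian.Ext.mk₀_comp_mk₀_assoc, hqe, Abelian.Ext.comp_zero]) (add_zero 1)
    obtain ⟨f, rfl⟩ := (Abelian.Ext.mk₀_bijective _ _).2 x
    -- The sequence splits over `A` because its quotient `F` is relative projective, so `f` extends
    -- to the middle term and its connecting class vanishes.
    obtain ⟨g, rfl⟩ := (hV S hS (exists_retraction hS hF)).2.2 f
    dsimp only
    rw [← Abelian.Ext.mk₀_comp_mk₀, hS.extClass_comp_assoc]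
  | succ n ih =>
    intro F hF e
    obtain ⟨Z, q, hq, hqe⟩ := exists_epi_mk₀_comp_eq_zero e
    have : Epi (freeCounit Z) := YDModule.epi_of_surjective _ (freeCounit_surjective Z)
    let S : ShortComplex (YDModule k A) := ShortComplex.mk _ _
      (Limits.kernel.condition (freeCounit Z ≫ q))
    have hS : S.ShortExact := { exact := ShortComplex.exact_kernel _ }
    obtain ⟨x, rfl⟩ := Abelian.Ext.contravariant_sequence_exact₃ hS V e (by
      change (Abelian.Ext.mk₀ (freeCounit Z ≫ q)).comp e _ = 0
      rw [← Abelian.Ext.mk₀_comp_mk₀_assoc, hqe, Abelian.Ext.comp_zero]) (add_comm 1 (n + 1))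
    rw [ih (.of_shortExact hS (isRelativeProjective_free _) hF) x, Abelian.Ext.comp_zero]

/-- This acyclicity is all that the rest of the proof takes from the alternative `h`. -/
lemma subsingleton_ext_free {V : YDModule k A} (h : IsCosemisimple k A ∨ IsRelativeInjective V)
    (M : RightComodule k A) (n : ℕ) : Subsingleton (Abelian.Ext.{u + 1} M.free V (n + 1)) := by
  obtain h | h := h
  · have := projective_free h M
    exact Abelian.Ext.subsingleton_of_projective _ _ _
  · exact subsingleton_of_forall_eq 0
      (ext_eq_zero_of_isRelativeInjective h n (isRelativeProjective_free M))

end Acyclic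

/-! ### The bar resolution of the trivial module and its Hom complex. -/

section BarResolution

variable {k A : Type u} [Field k] [Ring A] [HopfAlgebra k A]

variable (k A) in
lemma bar_zero_surjective : Function.Surjective (YDModule.lin (bar k A 0)) := fun t =>
  ⟨boxTmul t 1, by rw [bar_zero_boxTmul, YDModule.act_one]; rfl⟩

variable (k A) in
/-- The complex `⋯ → A^{⊠ 2} → A^{⊠ 1} → k → 0` is exact, by the contraction `t ↦ t ⊗ 1`. -/
lemma ker_bar (n : ℕ) : LinearMap.ker (YDModule.lin (bar k A n)) =
    LinearMap.range (YDModule.lin (bar k A (n + 1))) := by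
  apply le_antisymm
  · intro t ht
    -- For a cycle `t`, `bar (t ⊗ 1) = (-1)^(n+1) t`; the scalar cancels this sign.
    refine ⟨(-1 : k) ^ (n + 1) • boxTmul t 1, ?_⟩
    rw [map_smul, bar_succ_boxTmul, LinearMap.mem_ker.1 ht, zero_boxTmul, YDModule.act_one,
      LinearMap.id_apply, zero_add, smul_smul, ← mul_pow]
    simp
  · rintro _ ⟨t, rfl⟩
    exact bar_bar n t

variable (k A) in
/-- The syzygies of the bar resolution. -/
noncomputable abbrev barSyzygy (n : ℕ) : YDModule k A := Limits.image (bar k A n)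

lemma range_lin_image_ι {M N : YDModule k A} (f : M ⟶ N) :
    LinearMap.range (YDModule.lin (Limits.image.ι f)) = LinearMap.range (YDModule.lin f) := by
  have h := YDModule.surjective_of_epi (Limits.factorThruImage f)
  conv_rhs => rw [← Limits.image.fac f]
  rw [YDModule.lin_comp, LinearMap.range_comp_of_range_eq_top _ (LinearMap.range_eq_top.2 h)]

lemma ker_lin_factorThruImage {M N : YDModule k A} (f : M ⟶ N) :
    LinearMap.ker (YDModule.lin (Limits.factorThruImage f)) = LinearMap.ker (YDModule.lin f) := by
  have h := YDModule.injective_of_mono (Limits.image.ι f)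
  conv_rhs => rw [← Limits.image.fac f]
  rw [YDModule.lin_comp, LinearMap.ker_comp_of_ker_eq_bot _ (LinearMap.ker_eq_bot.2 h)]

lemma range_syzygy (n : ℕ) :
    LinearMap.range (YDModule.lin (Limits.image.ι (bar k A (n + 1)))) =
      LinearMap.ker (YDModule.lin (Limits.factorThruImage (bar k A n))) := by
  rw [range_lin_image_ι, ker_lin_factorThruImage, ker_bar]

/-- These sequences `0 → K (n+1) → A^{⊠ (n+1)} → K n → 0`, with `K n` the image of `bar k A n`, cut
the resolution into the pieces along which degrees are shifted. -/
lemma shortExact_syzygy (n : ℕ) :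
    (ShortComplex.mk (Limits.image.ι (bar k A (n + 1))) (Limits.factorThruImage (bar k A n))
      (YDModule.comp_eq_zero (range_syzygy n).le)).ShortExact :=
  YDModule.shortExact (YDModule.injective_of_mono _) (YDModule.surjective_of_epi _)
    (range_syzygy n)

variable (k A) in
/-- The zeroth syzygy is the trivial module. -/
noncomputable def barSyzygyZeroIso : barSyzygy k A 0 ≅ boxPow k A 0 :=
  have : Epi (bar k A 0) := YDModule.epi_of_surjective _ (bar_zero_surjective k A)
  have : Epi (Limits.image.ι (bar k A 0)) := epi_of_epi_fac (Limits.image.fac (bar k A 0))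
  have : IsIso (Limits.image.ι (bar k A 0)) := isIso_of_mono_of_epi _
  asIso (Limits.image.ι (bar k A 0))

/-- Under the adjunction, `∂` is precomposition with the differential of the bar resolution. -/
lemma freeLiftEquiv_diff (V : YDModule k A) (n : ℕ)
    (f : (boxPow k A n).colinearMaps V.toRightComodule) :
    freeLiftEquiv (boxPow k A (n + 1)).toRightComodule V (diff V n f) =
      bar k A (n + 1) ≫ (freeLiftEquiv (boxPow k A n).toRightComodule V f :) := by
  refine YDModule.hom_ext (box_ext fun t a => ?_)
  refine (boxLift_boxTmul (diff V n f) t a).trans ?_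
  refine Eq.trans ?_ (congrArg (YDModule.lin (boxLift f)) (bar_succ_boxTmul n t a)).symm
  -- Both sides equal `(f(bar t) + (-1)^(n+1) f̂(t)) ← a`, where `f̂ = boxLift f`: the recursion for
  -- `bar` and the definition of `∂` carry the same sign.
  rw [map_add, map_smul, YDModule.lin_act, boxLift_boxTmul, ← map_smul, ← map_add]
  rfl

/-- The cocycles of `∂` are the morphisms `A^{⊠ (n+1)} → V` that kill the image of `bar`. -/
noncomputable def kerDiffEquiv (V : YDModule k A) (n : ℕ)
    {f : boxPow k A (n + 2) ⟶ boxPow k A (n + 1)}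
    (hf : f = bar k A (n + 1)) :
    LinearMap.ker (diff V n) ≃ₗ[k] LinearMap.ker (Linear.leftComp k V f) :=
  (LinearEquiv.ofEq _ _ (by
    ext x
    change diff V n x = 0 ↔
      f ≫ (freeLiftEquiv (boxPow k A n).toRightComodule V x : boxPow k A (n + 1) ⟶ V) = 0
    rw [hf, ← freeLiftEquiv_diff]
    exact (LinearEquiv.map_eq_zero_iff _).symm)).trans
  ((freeLiftEquiv (boxPow k A n).toRightComodule V).ofSubmodule'
    (LinearMap.ker (Linear.leftComp k V f)))

lemma coe_kerDiffEquiv (V : YDModule k A) (n : ℕ)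
    {f : boxPow k A (n + 2) ⟶ boxPow k A (n + 1)}
    (hf : f = bar k A (n + 1)) (x : LinearMap.ker (diff V n)) :
    (kerDiffEquiv V n hf x).1 = freeLiftEquiv (boxPow k A n).toRightComodule V x.1 := rfl

/-- The cohomology of the Hom complex of the bar resolution in positive degrees. -/
lemma exists_ker_diff_gsCohomology_succ (V : YDModule k A)
    (h : IsCosemisimple k A ∨ IsRelativeInjective V) (n : ℕ) :
    ∃ φ : LinearMap.ker (diff V (n + 1)) →ₗ[k] GSCohomology V (n + 1),
      Function.Surjective φ ∧ ∀ x, φ x = 0 ↔ ∃ g, diff V n g = x.1 := by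
  obtain ⟨φ, hφ, hφ'⟩ := exists_ker_leftComp_ext.{u + 1} k
    (fun n => Limits.factorThruImage (bar k A n)) (fun n => Limits.image.ι (bar k A n))
    _ shortExact_syzygy V (fun m n => subsingleton_ext_free h (boxPow k A m).toRightComodule n)
    -- The syzygy of index `0` is `k`. Cochains of degree `n + 1` are morphisms from `A^{⊠ (n+2)}`,
    -- whence the index `j = n`.
    n 0 n (zero_add n)
  let θ := kerDiffEquiv V (n + 1) (Limits.image.fac (bar k A (n + 2)))
  let E := extCongrLeft.{u + 1} k (barSyzygyZeroIso k A) V (n + 1)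
  refine ⟨E.symm.toLinearMap ∘ₗ φ ∘ₗ θ.toLinearMap,
    E.symm.surjective.comp (hφ.comp θ.surjective), fun x => ?_⟩
  refine E.symm.map_eq_zero_iff.trans ((hφ' (θ x)).trans ?_)
  rw [Limits.image.fac, coe_kerDiffEquiv]
  refine ((freeLiftEquiv (boxPow k A n).toRightComodule V).surjective.exists).trans
    (exists_congr fun g => ?_)
  rw [← (freeLiftEquiv (boxPow k A (n + 1)).toRightComodule V).injective.eq_iff,
    freeLiftEquiv_diff]
  rfl

/-- The cohomology of the Hom complex of the bar resolution in degree zero. -/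
lemma exists_ker_diff_gsCohomology_zero (V : YDModule k A) :
    ∃ φ : LinearMap.ker (diff V 0) →ₗ[k] GSCohomology V 0, Function.Bijective φ := by
  let θ := kerDiffEquiv V 0 (Limits.image.fac (bar k A 1))
  -- By exactness at `A^{⊠ 1}`, morphisms from `A^{⊠ 1}` that kill the image of `bar k A 1` are
  -- morphisms from the zeroth syzygy. Acyclicity plays no role in this degree.
  let η := homEquivKer k (Limits.factorThruImage (bar k A 1))
    (shortExact_syzygy (k := k) (A := A) 0) V
  let E := extCongrLeft.{u + 1} k (barSyzygyZeroIso k A) V 0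
  exact ⟨(θ.trans (η.symm.trans
      ((Abelian.Ext.linearEquiv₀ (R := k)).symm.trans E.symm))).toLinearMap,
    LinearEquiv.bijective _⟩

end BarResolution

/-! ### Homology of the cochain complex as cocycles modulo coboundaries. -/

section Homology

lemma shortComplex_mk_congr {C : Type*} [Category* C] [Abelian C] {X Y Z : C} {f f' : X ⟶ Y}
    {g g' : Y ⟶ Z} (hf : f = f') (hg : g = g') (w : f ≫ g = 0) (w' : f' ≫ g' = 0) :
    ShortComplex.mk f g w = ShortComplex.mk f' g' w' := by
  subst hf hg
  rfl

/-- The homology in positive degrees of a complex given by a sequence of differentials. -/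
noncomputable def homologySuccIso {C : Type*} [Category* C] [Abelian C] (X : ℕ → C)
    (d : ∀ n, X n ⟶ X (n + 1)) (sq : ∀ n, d n ≫ d (n + 1) = 0) (n : ℕ) :
    (CochainComplex.of X d sq).homology (n + 1) ≅ (ShortComplex.mk _ _ (sq n)).homology :=
  ShortComplex.homologyMapIso
    ((CochainComplex.of X d sq).isoSc' n (n + 1) (n + 2) (by simp) (by simp) ≪≫
      eqToIso (shortComplex_mk_congr (CochainComplex.of_d X d n) (CochainComplex.of_d X d (n + 1))
        _ _))

/-- The homology in degree zero of a complex given by a sequence of differentials. -/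
noncomputable def homologyZeroIso {C : Type*} [Category* C] [Abelian C] (X : ℕ → C)
    (d : ∀ n, X n ⟶ X (n + 1)) (sq : ∀ n, d n ≫ d (n + 1) = 0) :
    (CochainComplex.of X d sq).homology 0 ≅
      (ShortComplex.mk (0 : X 0 ⟶ X 0) (d 0) Limits.zero_comp).homology :=
  ShortComplex.homologyMapIso
    -- Degree `0` has no predecessor, so by convention its predecessor is `0` itself, with zero
    -- differential.
    ((CochainComplex.of X d sq).isoSc' 0 0 1 (by simp) (by simp) ≪≫
      eqToIso (shortComplex_mk_congr (CochainComplex.of_d_ne X d (by simp))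
        (CochainComplex.of_d X d 0) _ _))

variable {k : Type u} [Field k]

lemma ofHom_diff_comp {A : Type u} [Ring A] [HopfAlgebra k A] (V : YDModule k A) (n : ℕ) :
    ModuleCat.ofHom (diff V n) ≫ ModuleCat.ofHom (diff V (n + 1)) = 0 := by
  ext f : 2
  exact diff_diff V n f

/-- First isomorphism theorem: the kernel of `φ` is the space of boundaries, so a surjection from
cocycles with this kernel identifies its target with homology. -/
lemma nonempty_linearEquiv_homology (S : ShortComplex (ModuleCat.{u} k)) {M : Type*}
    [AddCommGroup M] [Module k M] (φ : LinearMap.ker S.g.hom →ₗ[k] M)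
    (hφ : Function.Surjective φ) (hφ' : ∀ x, φ x = 0 ↔ ∃ y, S.f.hom y = x.1) :
    Nonempty (M ≃ₗ[k] S.homology) := by
  have hker : LinearMap.range S.moduleCatToCycles = LinearMap.ker φ := by
    ext x
    rw [LinearMap.mem_ker, hφ']
    exact exists_congr fun y => Subtype.ext_iff
  exact ⟨((Submodule.quotEquivOfEq _ _ hker).trans
    (φ.quotKerEquivOfSurjective hφ)).symm.trans S.moduleCatHomologyIso.toLinearEquiv.symm⟩

end Homology

end GerstenhaberSchack

/-! ### The theorem, in degree zero and in positive degrees. -/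

theorem mainTheorem11 {k A : Type u} [Field k] [Ring A] [HopfAlgebra k A]
    (V : GerstenhaberSchack.YDModule k A)
    (h : GerstenhaberSchack.IsCosemisimple k A ∨ GerstenhaberSchack.IsRelativeInjective V)
    (n : ℕ) :
    Nonempty (GerstenhaberSchack.GSCohomology V n ≃ₗ[k]
      (GerstenhaberSchack.gsComplex V).homology n) := by
  open GerstenhaberSchack in
  cases n with
  | zero =>
    obtain ⟨φ, hφ⟩ := exists_ker_diff_gsCohomology_zero V
    obtain ⟨e⟩ := nonempty_linearEquiv_homology
      (ShortComplex.mk (0 : ModuleCat.of k ((boxPow k A 0).colinearMaps V.toRightComodule) ⟶ _)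
        (ModuleCat.ofHom (diff V 0)) Limits.zero_comp)
      φ hφ.2 fun x => by
        rw [map_eq_zero_iff φ hφ.1]
        -- In degree zero the incoming map is zero, so being a boundary means being zero, which
        -- matches the injectivity of `φ`.
        exact ⟨fun hx => ⟨0, (congrArg Subtype.val hx).symm⟩,
          fun ⟨_, hx⟩ => Subtype.ext hx.symm⟩
    exact ⟨e.trans (homologyZeroIso
      (fun m => ModuleCat.of k ((boxPow k A m).colinearMaps V.toRightComodule))
      (fun m => ModuleCat.ofHom (diff V m)) (ofHom_diff_comp V)).toLinearEquiv.symm⟩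
  | succ n =>
    obtain ⟨φ, hφ, hφ'⟩ := exists_ker_diff_gsCohomology_succ V h n
    obtain ⟨e⟩ := nonempty_linearEquiv_homology
      (ShortComplex.mk (ModuleCat.ofHom (diff V n)) (ModuleCat.ofHom (diff V (n + 1)))
        (ofHom_diff_comp V n)) φ hφ hφ'
    exact ⟨e.trans (homologySuccIso
      (fun m => ModuleCat.of k ((boxPow k A m).colinearMaps V.toRightComodule))
      (fun m => ModuleCat.ofHom (diff V m)) (ofHom_diff_comp V) n).toLinearEquiv.symm⟩
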